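/- Let $q>2$, $0<h<1$ with $2/h\notin\mathbb Z$, put $\ell^*=\lceil 2/h\rceil$, and let $K,L\ge 3\ell^*$. Let $\Lambda=(V,E)$ be the $K\times L$ grid with periodic boundary conditions, $\mathcal X=\{1,\dots,q\}^V$, and $$H(\sigma)=-\sum_{(v,w)\in E}\mathbb 1_{\{\sigma(v)=\sigma(w)\}}+h\sum_{u\in V}\mathbb 1_{\{\sigma(u)=1\}},\qquad \sigma\in\mathcal X,$$ (the $q$-state Potts model with negative external magnetic field). Let $\mathbf 1\in\mathcal X$ be the configuration with all spins equal to $1$, and let $\mathcal X^s\subset\mathcal X$ be the set of stable states, that is, of global minima of $H$. A path is a finite sequence $\omega=(\omega_0,\dots,\omega_n)$ in $\mathcal X$ in which consecutive configurations differ in exactly one spin; its height is $\max_i H(\omega_i)$. For $\sigma\in\mathcal X$ and a non-empty $\mathcal A\subseteq\mathcal X$, a path from $\sigma$ to (an element of) $\mathcal A$ is optimal if its height equals the minimum $\Phi(\sigma,\mathcal A)$ of the heights of all such paths, and $\mathcal S(\sigma,\mathcal A)$ denotes the set of the configurations of energy $\Phi(\sigma,\mathcal A)$ that lie on some optimal path.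 A gate for the transition $\sigma\to\mathcal A$ is a set $\mathcal W\subseteq\mathcal S(\sigma,\mathcal A)$ that is visited by every optimal path from $\sigma$ to $\mathcal A$; a gate is minimal if each of its proper subsets is avoided by some optimal path. $\mathcal G(\sigma,\mathcal A)$ denotes the union of all minimal gates for $\sigma\to\mathcal A$. For a single target state $\eta$ we write $\sigma\to\eta$ and $\mathcal G(\sigma,\eta)$, meaning $\mathcal A=\{\eta\}$. Finally, let $\mathcal W(\mathbf 1,\mathcal X^s)$ be the set of all configurations in which, for some $t\in\{2,\dots,q\}$, all spins are $1$ except those, which are $t$, in a rectangle with side lengths $\ell^*-1$ and $\ell^*$ (in either orientation) together with one unit square attached to one of its sides of length $\ell^*$. Then, for every $\mathbf s\in\mathcal X^s$, the set $\mathcal W(\mathbf 1,\mathcal X^s)$ is a minimal gate for the transition $\mathbf 1\to\mathbf s$, and $$\mathcal G(\mathbf 1,\mathbf s)=\mathcal G(\mathbf 1,\mathcal X^s).$$ -/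

import Mathlib

/-! ### Energy landscapes -/

namespace EnergyLandscape

noncomputable section

variable {X : Type*}

/-- A path is a finite sequence `ω₀, …, ωₙ` with `Q(ωᵢ, ωᵢ₊₁) > 0` for all `i < n`. -/
abbrev Path (Q : X → X → ℝ) : Type _ := RelSeries {p : X × X | 0 < Q p.1 p.2}

/-- The height of a path: the maximal energy along it. -/
def height (H : X → ℝ) {Q : X → X → ℝ} (ω : Path Q) : ℝ :=
  Finset.univ.sup' Finset.univ_nonempty fun i : Fin (ω.length + 1) => H (ω i)

/-- The paths that start in `σ` and end in the target set `A`. -/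
def paths (Q : X → X → ℝ) (σ : X) (A : Set X) : Set (Path Q) :=
  {ω | ω.head = σ ∧ ω.last ∈ A}

/-- The communication height `Φ(σ, A)`: the minimal height of a path from `σ` to `A`
(for a single target state take `A = {σ'}`). -/
def commHeight (H : X → ℝ) (Q : X → X → ℝ) (σ : X) (A : Set X) : ℝ :=
  sInf (height H '' paths Q σ A)

/-- The optimal paths from `σ` to `A`. -/
def optPaths (H : X → ℝ) (Q : X → X → ℝ) (σ : X) (A : Set X) : Set (Path Q) :=
  {ω | ω ∈ paths Q σ A ∧ height H ω = commHeight H Q σ A}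

/-- The minimal saddles between `σ` and `A`. -/
def minimalSaddles (H : X → ℝ) (Q : X → X → ℝ) (σ : X) (A : Set X) : Set X :=
  {ξ | ∃ ω ∈ optPaths H Q σ A, ξ ∈ ω ∧ height H ω = H ξ}

/-- `W` is a gate for the transition from `σ` to `A`. -/
def IsGate (H : X → ℝ) (Q : X → X → ℝ) (σ : X) (A : Set X) (W : Set X) : Prop :=
  W ⊆ minimalSaddles H Q σ A ∧ ∀ ω ∈ optPaths H Q σ A, ∃ η ∈ W, η ∈ ω

/-- `W` is a minimal gate: a gate such that every proper subset is missed by some optimal path. -/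
def IsMinimalGate (H : X → ℝ) (Q : X → X → ℝ) (σ : X) (A : Set X) (W : Set X) : Prop :=
  IsGate H Q σ A W ∧ ∀ W', W' ⊂ W → ∃ ω ∈ optPaths H Q σ A, ∀ η ∈ W', η ∉ ω

/-- The union of all minimal gates for the transition from `σ` to `A`. -/
def gateUnion (H : X → ℝ) (Q : X → X → ℝ) (σ : X) (A : Set X) : Set X :=
  ⋃₀ {W | IsMinimalGate H Q σ A W}

/-- The stable states: the global minima of the energy. -/
def stableStates (H : X → ℝ) : Set X := {σ | ∀ η, H σ ≤ H η}

end

end EnergyLandscape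

/-! ### The Potts model on the `K × L` torus -/

namespace Potts

noncomputable section

/-- The spin values `1, …, q`. -/
abbrev Spin (q : ℕ) : Type := ↥(Finset.Icc 1 q)

/-- The spin value `1`. -/
def spinOne (q : ℕ) [NeZero q] : Spin q :=
  ⟨1, Finset.mem_Icc.2 ⟨le_rfl, Nat.one_le_iff_ne_zero.2 (NeZero.ne q)⟩⟩

/-- The vertices of the `K × L` grid with periodic boundary conditions. -/
abbrev Vertex (K L : ℕ) : Type := ZMod K × ZMod L

/-- Spin configurations. -/
abbrev Config (K L q : ℕ) : Type := Vertex K L → Spin q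

variable {K L q : ℕ}

/-- The configuration in which all the spins are equal to `1`. -/
def allOne (K L q : ℕ) [NeZero q] : Config K L q := fun _ => spinOne q

/-- The edges of the torus: every vertex is joined to the next one in its column and in its row. -/
def edges (K L : ℕ) [NeZero K] [NeZero L] : Finset (Sym2 (Vertex K L)) :=
  Finset.univ.image (fun v : Vertex K L => s(v, v + (1, 0))) ∪
    Finset.univ.image (fun v : Vertex K L => s(v, v + (0, 1)))

/-- The Hamiltonian with coupling constant `1` and negative external field `-h` on the spin `1`.
An edge `{v, w}` is mapped to the diagonal by `σ` exactly if `σ v = σ w`. -/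
def energy [NeZero K] [NeZero L] (h : ℝ) (σ : Config K L q) : ℝ :=
  -(∑ e ∈ edges K L, if (e.map σ).IsDiag then (1 : ℝ) else 0) +
    h * ∑ u : Vertex K L, if (σ u : ℕ) = 1 then (1 : ℝ) else 0

/-- The connectivity matrix of the single spin-flip dynamics. -/
def connectivity [NeZero K] [NeZero L] (σ σ' : Config K L q) : ℝ :=
  if hammingDist σ σ' = 1 then 1 / ((q : ℝ) * Fintype.card (Vertex K L)) else 0

/-- The rectangle on the torus with corner `v₀` and with `m` rows and `n` columns. -/
def rectangle (v₀ : Vertex K L) (m n : ℕ) : Set (Vertex K L) :=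
  {v | (v.1 - v₀.1).val < m ∧ (v.2 - v₀.2).val < n}

/-- The regions that consist of a rectangle `a × b` (in either orientation) and a bar `1 × l`
adjacent to one of its sides of length `b`; the four cases are the four possible sides, and `c` is
the position of the bar along the side. -/
def rectanglesWithBar (K L a b l : ℕ) : Set (Set (Vertex K L)) :=
  {R | ∃ (v₀ : Vertex K L) (c : ℕ), c + l ≤ b ∧
    (R = rectangle v₀ a b ∪ rectangle (v₀ + ((a : ZMod K), (c : ZMod L))) 1 l ∨
     R = rectangle v₀ a b ∪ rectangle (v₀ + ((-1 : ZMod K), (c : ZMod L))) 1 l ∨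
     R = rectangle v₀ b a ∪ rectangle (v₀ + ((c : ZMod K), (a : ZMod L))) l 1 ∨
     R = rectangle v₀ b a ∪ rectangle (v₀ + ((c : ZMod K), (-1 : ZMod L))) l 1)}

/-- The configurations in which all the spins are `r`, except those, which are `s`, in a rectangle
`a × b` with a bar `1 × l` adjacent to one of the sides of length `b`. -/
def barB (a b l : ℕ) (r s : Spin q) : Set (Config K L q) :=
  {σ | ∃ R ∈ rectanglesWithBar K L a b l, ∀ v, (v ∈ R → σ v = s) ∧ (v ∉ R → σ v = r)}

/-- The critical length `⌈2 / h⌉`. -/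
def criticalLength (h : ℝ) : ℕ := ⌈2 / h⌉₊

/-- The configurations with all spins `1`, except those, which are equal to some `t ≠ 1`, in a
quasi-square with a unit protuberance on one of its longest sides. -/
def criticalSet (K L q : ℕ) [NeZero q] (h : ℝ) : Set (Config K L q) :=
  ⋃ t ∈ {t : Spin q | t ≠ spinOne q},
    barB (criticalLength h - 1) (criticalLength h) 1 (spinOne q) t

end

end Potts

/-!
Up to an additive constant, the energy of a configuration is the number of disagreeing edges minus
`h` times the area, the number of spins different from `1`. Put `k = ℓ* - 1`, so that
`h * k < 2 < h * (k + 1)`. On a torus of side lengths at least `3 (k + 1)`, a set of small perimeter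
contains no full row and no full column, hence it has at least the perimeter of the smallest box
around it. A path from `1` to a stable state has to cross the areas from `k (k + 1) + 1` to
`(k + 1) ^ 2`, where the half perimeter is at least `2 (k + 1)`. If it stays at the critical height,
then all the boxes met on the way have the same half perimeter `2 (k + 1)`; the box is a
`(k + 1) × (k + 1)` square at the area `(k + 1) ^ 2`, hence already at the last passage through the
area `k (k + 1) + 1`. One step earlier the droplet is a rectangle `k × (k + 1)`, and so the path
visits the critical set.

Conversely, every critical configuration is the strict unique maximum on some path: a droplet that
grows row by row and column by column reaches it from below and leaves it downwards, and two
constant configurations without spins `1` are joined by a growing droplet far below the critical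
height. Hence every gate contains the critical set, which is itself a gate, and the critical set is
the only minimal gate.
-/

/-! ### Bottlenecks -/

namespace EnergyLandscape

variable {X : Type*} {H : X → ℝ} {Q : X → X → ℝ} {σ : X} {A W W' : Set X} {Γ : ℝ}

theorem height_le_iff {ω : Path Q} : height H ω ≤ Γ ↔ ∀ x ∈ ω, H x ≤ Γ := by
  rw [height, Finset.sup'_le_iff]
  exact ⟨by rintro h x ⟨i, rfl⟩; exact h i (Finset.mem_univ _), fun h i _ => h _ ⟨i, rfl⟩⟩

theorem le_height {ω : Path Q} {x : X} (hx : x ∈ ω) : H x ≤ height H ω :=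
  height_le_iff.1 le_rfl x hx

theorem exists_path_extension {P : X → Prop} (ω : Path Q) {b : X}
    (h : Relation.ReflTransGen (fun x y => 0 < Q x y ∧ P y) ω.last b) :
    ∃ ω' : Path Q, ω'.head = ω.head ∧ ω'.last = b ∧ (∀ x ∈ ω, x ∈ ω') ∧
      ∀ x ∈ ω', x ∈ ω ∨ P x := by
  induction h with
  | refl => exact ⟨ω, rfl, rfl, fun _ => id, fun _ => Or.inl⟩
  | @tail b c _ hbc ih =>
    obtain ⟨ω', hhead, rfl, hsub, hmem⟩ := ih
    refine ⟨ω'.snoc c hbc.1, by simpa using hhead, by simp, fun x hx => ?_, fun x hx => ?_⟩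
    · exact RelSeries.mem_snoc.2 (Or.inl (hsub x hx))
    · rcases RelSeries.mem_snoc.1 hx with hx | rfl
      · exact hmem x hx
      · exact Or.inr hbc.2

theorem exists_mem_paths_of_reflTransGen {P : X → Prop} {w a : X} (hσ : P σ)
    (hσw : Relation.ReflTransGen (fun x y => 0 < Q x y ∧ P y) σ w)
    (hwa : Relation.ReflTransGen (fun x y => 0 < Q x y ∧ P y) w a) :
    ∃ ω ∈ paths Q σ {a}, w ∈ ω ∧ ∀ x ∈ ω, P x := by
  obtain ⟨ω, hhead, rfl, -, hP⟩ :=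
    exists_path_extension (RelSeries.singleton _ σ) (by simpa using hσw)
  obtain ⟨ω', hhead', hlast', hsub, hP'⟩ := exists_path_extension ω hwa
  refine ⟨ω', ⟨by simp [hhead', hhead], hlast'⟩, hsub _ ω.last_mem, fun x hx => ?_⟩
  rcases hP' x hx with hx | hx
  · rcases hP x hx with ⟨i, rfl⟩ | hx
    · exact hσ
    · exact hx
  · exact hx

theorem exists_mem_of_leaves {B : Set X} {ω : Path Q}
    (hstep : ∀ x ∈ ω, ∀ y ∈ ω, x ∈ B → 0 < Q x y → y ∉ W → y ∈ B)
    (hhead : ω.head ∈ B) (hlast : ω.last ∉ B) : ∃ η ∈ W, η ∈ ω := by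
  by_contra! hW
  have mem_B (n : ℕ) (hn : n < ω.length + 1) : ω ⟨n, hn⟩ ∈ B := by
    induction n with
    | zero => exact hhead
    | succ n ih =>
      exact hstep _ ⟨_, rfl⟩ _ ⟨_, rfl⟩ (ih (by omega)) (ω.step ⟨n, by omega⟩)
        fun h => hW _ h ⟨_, rfl⟩
  exact hlast (mem_B ω.length (by omega))

theorem isMinimalGate_iff_minimal :
    IsMinimalGate H Q σ A W ↔ Minimal (IsGate H Q σ A) W := by
  rw [minimal_iff_forall_lt, IsMinimalGate]
  refine and_congr_right fun hW => forall₂_congr fun W' hW' => ?_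
  simp [IsGate, (hW'.subset.trans hW.1 : W' ⊆ _)]

/-- The set `W` is a *bottleneck* at level `Γ` for the transition from `σ` to `A` if every path of
height at most `Γ` visits `W`, while `W` lies at level `Γ` and each of its points is the only state
of energy at least `Γ` on some path. -/
structure IsBottleneck (H : X → ℝ) (Q : X → X → ℝ) (σ : X) (A W : Set X) (Γ : ℝ) : Prop where
  nonempty : W.Nonempty
  exists_mem : ∀ ω ∈ paths Q σ A, height H ω ≤ Γ → ∃ η ∈ W, η ∈ ω
  energy_eq : ∀ w ∈ W, H w = Γ
  exists_path : ∀ w ∈ W, ∃ ω ∈ paths Q σ A, w ∈ ω ∧ ∀ x ∈ ω, x ≠ w → H x < Γ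

namespace IsBottleneck

variable (hW : IsBottleneck H Q σ A W Γ)
include hW

theorem le_height {ω : Path Q} (hω : ω ∈ paths Q σ A) : Γ ≤ height H ω := by
  by_contra! hlt
  obtain ⟨η, hη, hηω⟩ := hW.exists_mem ω hω hlt.le
  exact hlt.not_ge (hW.energy_eq η hη ▸ EnergyLandscape.le_height hηω)

theorem height_eq {w : X} (hw : w ∈ W) {ω : Path Q} (hω : ω ∈ paths Q σ A)
    (hlt : ∀ x ∈ ω, x ≠ w → H x < Γ) : height H ω = Γ := by
  refine (height_le_iff.2 fun x hx => ?_).antisymm (hW.le_height hω)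
  obtain rfl | hxw := eq_or_ne x w
  · exact (hW.energy_eq x hw).le
  · exact (hlt x hx hxw).le

theorem commHeight_eq : commHeight H Q σ A = Γ := by
  obtain ⟨w, hw⟩ := hW.nonempty
  obtain ⟨ω, hω, -, hlt⟩ := hW.exists_path w hw
  exact IsLeast.csInf_eq
    ⟨⟨ω, hω, hW.height_eq hw hω hlt⟩, Set.forall_mem_image.2 fun _ => hW.le_height⟩

theorem exists_optPath {w : X} (hw : w ∈ W) :
    ∃ ω ∈ optPaths H Q σ A, w ∈ ω ∧ ∀ x ∈ ω, x ≠ w → H x < Γ := by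
  obtain ⟨ω, hω, hwω, hlt⟩ := hW.exists_path w hw
  exact ⟨ω, ⟨hω, (hW.height_eq hw hω hlt).trans hW.commHeight_eq.symm⟩, hwω, hlt⟩

theorem isGate : IsGate H Q σ A W := by
  refine ⟨fun w hw => ?_, fun ω hω => hW.exists_mem ω hω.1 (hω.2.trans hW.commHeight_eq).le⟩
  obtain ⟨ω, hω, hwω, -⟩ := hW.exists_optPath hw
  exact ⟨ω, hω, hwω, by rw [hω.2, hW.commHeight_eq, hW.energy_eq w hw]⟩

theorem subset_of_isGate (hW' : IsGate H Q σ A W') : W ⊆ W' := by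
  intro w hw
  obtain ⟨ω, hω, hwω, hlt⟩ := hW.exists_optPath hw
  obtain ⟨η, hη, hηω⟩ := hW'.2 ω hω
  obtain ⟨ω', hω', -, hη'⟩ := hW'.1 hη
  rw [hω'.2, hW.commHeight_eq] at hη'
  obtain rfl : η = w := by_contra fun hηw => (hlt η hηω hηw).ne' hη'
  exact hη

theorem isMinimalGate_iff : IsMinimalGate H Q σ A W' ↔ W' = W := by
  have hleast : IsLeast {W' | IsGate H Q σ A W'} W := ⟨hW.isGate, fun _ => hW.subset_of_isGate⟩
  rw [isMinimalGate_iff_minimal]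
  exact hleast.minimal_iff

end IsBottleneck

end EnergyLandscape

namespace Potts

/-! ### The energy of a configuration -/

section Disagreements

variable {G T : Type*} [AddCommGroup G] [DecidableEq G] [DecidableEq T]

/-- The number of points at which `f` changes its value in the direction `e`. -/
def disagreements [Fintype G] (e : G) (f : G → T) : ℕ :=
  (Finset.univ.filter fun w => f w ≠ f (w + e)).card

/-- The points of `A` from which a step in the direction `e` leads out of `A`. -/
def exits (e : G) (A : Finset G) : Finset G := A.filter fun w => w + e ∉ A

theorem mem_exits {e w : G} {A : Finset G} : w ∈ exits e A ↔ w ∈ A ∧ w + e ∉ A :=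
  Finset.mem_filter

theorem card_entrances [Fintype G] (e : G) (A : Finset G) :
    (Finset.univ.filter fun w => w ∉ A ∧ w + e ∈ A).card = (exits e A).card := by
  have hcard : A.card = (Finset.univ.filter fun w => w + e ∈ A).card :=
    (Finset.card_bij (fun w _ => w + e) (by simp) (by simp) fun w hw => ⟨w - e, by simpa⟩).symm
  rw [show exits e A = A \ Finset.univ.filter fun w => w + e ∈ A by ext; simp [mem_exits],
    Finset.card_sdiff_comm hcard]
  congr 1
  ext w
  simp [and_comm]

theorem disagreements_eq_two_mul_card_exits_add [Fintype G] (e : G) (f : G → T) {a : T}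
    {A : Finset G} (hA : ∀ w, w ∈ A ↔ f w ≠ a) :
    disagreements e f = 2 * (exits e A).card +
      (Finset.univ.filter fun w => w ∈ A ∧ w + e ∈ A ∧ f w ≠ f (w + e)).card := by
  have hexits : exits e A = Finset.univ.filter fun w => w ∈ A ∧ w + e ∉ A := by
    ext w; simp [mem_exits]
  rw [two_mul]
  nth_rw 2 [← card_entrances e A]
  rw [hexits, disagreements]
  simp only [Finset.card_filter, ← Finset.sum_add_distrib]
  refine Finset.sum_congr rfl fun w _ => ?_
  have hw := hA w
  have hwe := hA (w + e)
  grind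

theorem card_exits_insert_le_add_one (e v : G) (A : Finset G) :
    (exits e (insert v A)).card ≤ (exits e A).card + 1 := by
  refine (Finset.card_le_card fun w hw => ?_).trans (Finset.card_insert_le v (exits e A))
  simp only [Finset.mem_insert, mem_exits, not_or] at hw ⊢
  exact hw.1.imp_right fun hwA => ⟨hwA, hw.2.2⟩

theorem card_exits_insert_le {e v : G} {A : Finset G} (hv : v ∉ A)
    (hve : v + e ∈ A ∨ v - e ∈ A) : (exits e (insert v A)).card ≤ (exits e A).card := by
  rcases hve with hve | hve
  · refine Finset.card_le_card fun w hw => ?_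
    rw [mem_exits, Finset.mem_insert, Finset.mem_insert, not_or] at hw
    obtain ⟨rfl | hwA, -, hwe⟩ := hw
    · exact absurd hve hwe
    · exact mem_exits.2 ⟨hwA, hwe⟩
  · have hexit : v - e ∈ exits e A := mem_exits.2 ⟨hve, by rwa [sub_add_cancel]⟩
    refine (Finset.card_le_card (t := insert v ((exits e A).erase (v - e))) fun w hw => ?_).trans
      ((Finset.card_insert_le _ _).trans (Finset.card_erase_add_one hexit).le)
    simp only [Finset.mem_insert, mem_exits, not_or, Finset.mem_erase] at hw ⊢
    exact hw.1.imp_right fun hwA => ⟨fun h => hw.2.1 (by rw [h, sub_add_cancel]), hwA, hw.2.2⟩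

end Disagreements

variable {K L q : ℕ}

section Energy

variable [NeZero K] [NeZero L]

/-- The number of edges of the torus on which `f` changes its value. -/
def wall {T : Type*} [DecidableEq T] (f : Vertex K L → T) : ℕ :=
  disagreements ((1, 0) : Vertex K L) f + disagreements ((0, 1) : Vertex K L) f

theorem zmod_two_ne_zero {n : ℕ} (hn : 3 ≤ n) : (2 : ZMod n) ≠ 0 := fun h =>
  absurd (Nat.le_of_dvd two_pos ((ZMod.natCast_eq_zero_iff 2 n).1 (by exact_mod_cast h)))
    (by omega)

theorem zmod_one_ne_zero {n : ℕ} (hn : 3 ≤ n) : (1 : ZMod n) ≠ 0 := fun h =>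
  zmod_two_ne_zero hn (by rw [← one_add_one_eq_two, h, add_zero])

theorem sum_boole_vertex (p : Vertex K L → Prop) [DecidablePred p] :
    ∑ v, (if p v then (1 : ℝ) else 0) = K * L - (Finset.univ.filter fun v => ¬ p v).card := by
  have h := Finset.card_filter_add_card_filter_not (s := (Finset.univ : Finset (Vertex K L))) p
  rw [Finset.card_univ, Fintype.card_prod, ZMod.card, ZMod.card] at h
  rw [Finset.sum_boole, eq_sub_iff_add_eq]
  exact_mod_cast h

theorem sum_image_edges (σ : Config K L q) {e : Vertex K L} (he : e + e ≠ 0) :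
    ∑ x ∈ Finset.univ.image (fun v : Vertex K L => s(v, v + e)),
      (if (x.map σ).IsDiag then (1 : ℝ) else 0) = K * L - disagreements e σ := by
  rw [Finset.sum_image]
  · simp only [Sym2.map_mk, Sym2.mk_isDiag_iff]
    exact sum_boole_vertex _
  · intro v _ w _ hvw
    rcases Sym2.eq_iff.1 hvw with h | ⟨rfl, h⟩
    · exact h.1
    · exact absurd (by simpa [add_assoc] using h) he

theorem disjoint_image_edges (hK : 3 ≤ K) :
    Disjoint (Finset.univ.image fun v : Vertex K L => s(v, v + (1, 0)))
      (Finset.univ.image fun v : Vertex K L => s(v, v + (0, 1))) := by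
  have h1 := zmod_one_ne_zero hK
  simp only [Finset.disjoint_left, Finset.mem_image, Finset.mem_univ, true_and]
  rintro _ ⟨v, rfl⟩ ⟨w, hw⟩
  rcases Sym2.eq_iff.1 hw with ⟨rfl, h⟩ | ⟨rfl, h⟩ <;>
    simpa [h1] using congrArg Prod.fst h

variable [NeZero q]

/-- The droplet of a configuration: the set of vertices whose spin is not `1`. -/
def nonOne (σ : Config K L q) : Finset (Vertex K L) :=
  Finset.univ.filter fun v => σ v ≠ spinOne q

theorem mem_nonOne {σ : Config K L q} {v : Vertex K L} : v ∈ nonOne σ ↔ σ v ≠ spinOne q := by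
  simp [nonOne]

theorem energy_eq (hK : 3 ≤ K) (hL : 3 ≤ L) (h : ℝ) (σ : Config K L q) :
    energy h σ = -2 * (K * L) + h * (K * L) + wall σ - h * (nonOne σ).card := by
  have hfst : ((1, 0) + (1, 0) : Vertex K L) ≠ 0 := fun h =>
    zmod_two_ne_zero hK (by simpa [one_add_one_eq_two] using congrArg Prod.fst h)
  have hsnd : ((0, 1) + (0, 1) : Vertex K L) ≠ 0 := fun h =>
    zmod_two_ne_zero hL (by simpa [one_add_one_eq_two] using congrArg Prod.snd h)
  have hspin (a : Spin q) : (a : ℕ) = 1 ↔ a = spinOne q := by simp [spinOne, Subtype.ext_iff]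
  simp only [energy, edges, hspin]
  rw [Finset.sum_union (disjoint_image_edges hK), sum_image_edges σ hfst, sum_image_edges σ hsnd,
    sum_boole_vertex, wall, nonOne]
  push_cast
  ring

theorem connectivity_pos_iff {σ σ' : Config K L q} :
    0 < connectivity σ σ' ↔ hammingDist σ σ' = 1 := by
  have hq : (0 : ℝ) < q := Nat.cast_pos.2 (NeZero.pos q)
  have hV : (0 : ℝ) < Fintype.card (Vertex K L) := Nat.cast_pos.2 Fintype.card_pos
  unfold connectivity
  split_ifs with h
  · simpa only [h, iff_true] using div_pos one_pos (mul_pos hq hV)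
  · simp [h]

theorem connectivity_update_pos {σ : Config K L q} {v : Vertex K L} {c : Spin q} (hv : σ v ≠ c) :
    0 < connectivity σ (Function.update σ v c) := by
  rw [connectivity_pos_iff, hammingDist, Finset.card_eq_one]
  refine ⟨v, ?_⟩
  ext w
  by_cases hw : w = v
  · subst hw; simp [hv]
  · simp [hw]

theorem exists_update_of_connectivity_pos {σ σ' : Config K L q} (h : 0 < connectivity σ σ') :
    ∃ v, ∀ w, w ≠ v → σ' w = σ w := by
  rw [connectivity_pos_iff, hammingDist, Finset.card_eq_one] at h
  obtain ⟨v, hv⟩ := h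
  refine ⟨v, fun w hw => by_contra fun hne => hw (Finset.mem_singleton.1 ?_)⟩
  rw [← hv]
  simpa using Ne.symm hne

end Energy

/-! ### Cyclic intervals -/

section Arcs

variable {n m : ℕ} [NeZero n] {S : Finset (ZMod n)} {a x x₀ : ZMod n}

theorem zmod_forall_of_succ {p : ZMod n → Prop} (hx₀ : p x₀) (hsucc : ∀ x, p x → p (x + 1))
    (x : ZMod n) : p x := by
  have hnat (i : ℕ) : p (x₀ + i) := by
    induction i with
    | zero => simpa using hx₀
    | succ i ih => simpa [add_assoc] using hsucc _ ih
  simpa using hnat (x - x₀).val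

theorem zmod_val_add_one (hx : x + 1 ≠ 0) : (x + 1).val = x.val + 1 := by
  have hcast : x + 1 = ((x.val + 1 : ℕ) : ZMod n) := by simp
  have hne : x.val + 1 ≠ n := fun h => hx (by rw [hcast, h, ZMod.natCast_self])
  rw [hcast, ZMod.val_natCast_of_lt (lt_of_le_of_ne x.val_lt hne)]

theorem val_add_one_sub (hx : x + 1 ≠ x₀) : (x + 1 - x₀).val = (x - x₀).val + 1 := by
  rw [add_sub_right_comm]
  exact zmod_val_add_one fun h => hx (by rwa [← add_sub_right_comm, sub_eq_zero] at h)

/-- The cyclic interval of length `m` that starts in `x₀`; it is the whole cycle if `n ≤ m`. -/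
def arc (x₀ : ZMod n) (m : ℕ) : Finset (ZMod n) :=
  Finset.univ.filter fun x => (x - x₀).val < m

theorem mem_arc : x ∈ arc x₀ m ↔ (x - x₀).val < m := by simp [arc]

theorem self_mem_arc : x₀ ∈ arc x₀ m ↔ 0 < m := by simp [mem_arc]

theorem arc_one : arc x₀ 1 = {x₀} := by
  ext x
  simp [mem_arc, ZMod.val_eq_zero, sub_eq_zero]

theorem arc_univ : arc x₀ n = Finset.univ := by
  ext x
  simp [mem_arc, ZMod.val_lt]

theorem arc_eq_image (hm : m ≤ n) : arc x₀ m = (Finset.range m).image fun i : ℕ => x₀ + i := by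
  ext x
  simp only [mem_arc, Finset.mem_image, Finset.mem_range]
  constructor
  · exact fun hx => ⟨_, hx, by simp⟩
  · rintro ⟨i, hi, rfl⟩
    rwa [add_sub_cancel_left, ZMod.val_natCast_of_lt (hi.trans_le hm)]

omit [NeZero n] in
theorem add_natCast_injOn : Set.InjOn (fun i : ℕ => x₀ + (i : ZMod n)) (Set.Iio n) := by
  intro i hi j hj hij
  rw [← ZMod.val_natCast_of_lt hi, ← ZMod.val_natCast_of_lt hj, add_left_cancel hij]

theorem card_arc (hm : m ≤ n) : (arc x₀ m).card = m := by
  rw [arc_eq_image hm, Finset.card_image_of_injOn, Finset.card_range]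
  exact add_natCast_injOn.mono fun i hi => (Finset.mem_range.1 hi).trans_le hm

theorem arc_succ (hm : m < n) : arc x₀ (m + 1) = insert (x₀ + (m : ZMod n)) (arc x₀ m) := by
  rw [arc_eq_image hm, arc_eq_image hm.le, Finset.range_add_one, Finset.image_insert]

theorem add_natCast_notMem_arc (hm : m < n) : x₀ + (m : ZMod n) ∉ arc x₀ m := by
  rw [mem_arc, add_sub_cancel_left, ZMod.val_natCast_of_lt hm]
  exact lt_irrefl m

theorem val_sub_pred (hx : x ≠ x₀ - 1) : (x - (x₀ - 1)).val = (x - x₀).val + 1 := by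
  rw [← val_add_one_sub fun h => hx (eq_sub_of_add_eq h)]
  congr 1
  ring

theorem arc_pred : arc (x₀ - 1) (m + 1) = insert (x₀ - 1) (arc x₀ m) := by
  ext x
  by_cases hx : x = x₀ - 1
  · simp [hx, self_mem_arc]
  · simp [mem_arc, val_sub_pred hx, hx]

theorem sub_one_notMem_arc (hm : m < n) : x₀ - 1 ∉ arc x₀ m := by
  intro hmem
  have hcard := card_arc (x₀ := x₀ - 1) hm
  rw [arc_pred, Finset.insert_eq_of_mem hmem, card_arc hm.le] at hcard
  omega

theorem add_one_eq_of_notMem_arc (hx : x ∉ arc x₀ m) (hx' : x + 1 ∈ arc x₀ m) : x + 1 = x₀ := by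
  by_contra hne
  rw [mem_arc] at hx hx'
  rw [val_add_one_sub hne] at hx'
  omega

theorem add_natCast_mem_arc {c : ℕ} (hc : c < m) : x₀ + (c : ZMod n) ∈ arc x₀ m := by
  rw [mem_arc, add_sub_cancel_left, ZMod.val_natCast]
  exact (Nat.mod_le c n).trans_lt hc

theorem card_exits_arc_le (x₀ : ZMod n) (m : ℕ) : (exits 1 (arc x₀ m)).card ≤ 1 := by
  have hval (x : ZMod n) (hx : x ∈ exits 1 (arc x₀ m)) : (x - x₀).val + 1 = m := by
    rw [mem_exits, mem_arc] at hx
    have hne : x + 1 ≠ x₀ := fun h => hx.2 (h ▸ self_mem_arc.2 (Nat.zero_lt_of_lt hx.1))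
    rw [mem_arc, val_add_one_sub hne] at hx
    omega
  refine Finset.card_le_one.2 fun x hx y hy =>
    sub_left_injective (b := x₀) (ZMod.val_injective n ?_)
  exact Nat.succ_injective ((hval x hx).trans (hval y hy).symm)

theorem exists_insert_eq_arc (hm : m < n) (hx : x = x₀ + m ∨ x = x₀ - 1) :
    ∃ x₁, insert x (arc x₀ m) = arc x₁ (m + 1) := by
  rcases hx with rfl | rfl
  · exact ⟨x₀, (arc_succ hm).symm⟩
  · exact ⟨x₀ - 1, arc_pred.symm⟩

theorem notMem_arc_of_eq (hm : m < n) (hx : x = x₀ + m ∨ x = x₀ - 1) : x ∉ arc x₀ m := by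
  rcases hx with rfl | rfl
  · exact add_natCast_notMem_arc hm
  · exact sub_one_notMem_arc hm

theorem add_one_or_sub_one_mem_arc (hm0 : 0 < m) (hm : m < n)
    (hx : x = x₀ + m ∨ x = x₀ - 1) : x + 1 ∈ arc x₀ m ∨ x - 1 ∈ arc x₀ m := by
  rcases hx with rfl | rfl
  · right
    obtain ⟨m, rfl⟩ := Nat.exists_eq_add_of_lt hm0
    rw [Nat.zero_add, arc_succ (by omega)]
    exact Finset.mem_insert.2 (Or.inl (by push_cast; ring))
  · exact Or.inl (by simpa [self_mem_arc])

/-- A proper cyclic interval, possibly empty, described by the number of its exits. -/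
def IsArc (S : Finset (ZMod n)) : Prop := S ≠ Finset.univ ∧ (exits 1 S).card ≤ 1

theorem exits_one_nonempty (hS : S.Nonempty) (huniv : S ≠ Finset.univ) : (exits 1 S).Nonempty := by
  obtain ⟨x, hx⟩ := hS
  by_contra! hexits
  refine huniv (Finset.eq_univ_iff_forall.2 (zmod_forall_of_succ hx fun y hy => ?_))
  by_contra hy'
  exact Finset.notMem_empty y (hexits ▸ mem_exits.2 ⟨hy, hy'⟩)

theorem IsArc.eq_of_add_one_notMem (hS : IsArc S) {y : ZMod n} (hx : x ∈ S) (hx' : x + 1 ∉ S)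
    (hy : y ∈ S) (hy' : y + 1 ∉ S) : x = y :=
  Finset.card_le_one.1 hS.2 x (mem_exits.2 ⟨hx, hx'⟩) y (mem_exits.2 ⟨hy, hy'⟩)

theorem eq_of_card_exits_le_one (hS : (exits 1 S).card ≤ 1) {T : Type*} {f : ZMod n → T}
    (hf : ∀ x ∈ S, x + 1 ∈ S → f x = f (x + 1)) {y : ZMod n} (hx : x ∈ S) (hy : y ∈ S) :
    f x = f y := by
  by_cases huniv : S = Finset.univ
  · simp only [huniv, Finset.mem_univ, forall_const] at hf
    exact zmod_forall_of_succ (p := fun y => f x = f y) rfl (fun y hxy => hxy.trans (hf y)) y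
  obtain ⟨z, hz⟩ := exits_one_nonempty ⟨x, hx⟩ huniv
  suffices h : ∀ x ∈ S, f x = f z from (h x hx).trans (h y hy).symm
  -- Otherwise the points with `f x ≠ f z` would be closed under successors and exhaust the cycle.
  intro x hx
  by_contra hne
  refine (zmod_forall_of_succ (p := fun x => x ∈ S ∧ f x ≠ f z) ⟨hx, hne⟩ ?_ z).2 rfl
  rintro u ⟨hu, hune⟩
  have hu' : u + 1 ∈ S := by_contra fun h =>
    hune (by rw [Finset.card_le_one.1 hS u (mem_exits.2 ⟨hu, h⟩) z hz])
  exact ⟨hu', hf u hu hu' ▸ hune⟩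

theorem exists_notMem_sub_one (hS : S.Nonempty) (huniv : S ≠ Finset.univ) :
    ∃ x₀ ∈ S, x₀ - 1 ∉ S := by
  by_contra! hpred
  obtain ⟨x, hx⟩ := hS
  refine huniv (Finset.eq_univ_iff_forall.2 fun y => neg_neg y ▸ ?_)
  exact zmod_forall_of_succ (p := fun y => -y ∈ S) (x₀ := -x) (by simpa using hx)
    (fun y hy => by simpa [sub_eq_add_neg, add_comm] using hpred _ hy) (-y)

theorem exists_arc_subset (hx₀ : x₀ ∈ S) (huniv : S ≠ Finset.univ) :
    ∃ m, 0 < m ∧ m < n ∧ arc x₀ m ⊆ S ∧ x₀ + (m : ZMod n) ∉ S := by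
  obtain ⟨u, hu⟩ : ∃ u, u ∉ S := by simpa [Finset.eq_univ_iff_forall] using huniv
  have hexists : ∃ m : ℕ, x₀ + (m : ZMod n) ∉ S := ⟨(u - x₀).val, by simpa using hu⟩
  classical
  have hlt : Nat.find hexists < n :=
    (Nat.find_min' hexists (by simpa using hu)).trans_lt (u - x₀).val_lt
  refine ⟨Nat.find hexists, ?_, hlt, fun x hx => ?_, Nat.find_spec hexists⟩
  · simpa [Nat.find_eq_zero] using hx₀
  · simpa using Nat.find_min hexists (mem_arc.1 hx)

theorem IsArc.exists_eq_arc (hS : IsArc S) (hne : S.Nonempty) : ∃ x₀, S = arc x₀ S.card := by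
  obtain ⟨x₀, hx₀, hpred⟩ := exists_notMem_sub_one hne hS.1
  obtain ⟨m, hm0, hmn, hsub, hm⟩ := exists_arc_subset hx₀ hS.1
  suffices hSm : S = arc x₀ m from ⟨x₀, by rw [hSm, card_arc hmn.le]⟩
  obtain ⟨l, rfl⟩ : ∃ l, m = l + 1 := ⟨m - 1, by omega⟩
  have hlS : x₀ + (l : ZMod n) ∈ S :=
    hsub (by rw [arc_succ (by omega)]; exact Finset.mem_insert_self _ _)
  have hl : x₀ + (l : ZMod n) + 1 ∉ S := by simpa [add_assoc] using hm
  refine Finset.Subset.antisymm (fun x hx => ?_) hsub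
  -- The exit is `x₀ + l`, so a point of `S` beyond it would have all its successors in `S \ arc`.
  by_contra hxm
  refine (zmod_forall_of_succ (p := fun x => x ∈ S ∧ x ∉ arc x₀ (l + 1)) ⟨hx, hxm⟩ ?_ x₀).2
    (self_mem_arc.2 hm0)
  rintro y ⟨hy, hym⟩
  have hy1 : y + 1 ∈ S := by
    by_contra hy1
    rw [hS.eq_of_add_one_notMem hy hy1 hlS hl, mem_arc, add_sub_cancel_left,
      ZMod.val_natCast_of_lt (by omega)] at hym
    omega
  exact ⟨hy1, fun h => hpred (by rwa [← add_one_eq_of_notMem_arc hym h, add_sub_cancel_right])⟩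

theorem IsArc.eq_or_eq_of_insert (hS : IsArc (insert a (arc x₀ m))) (hm : 0 < m)
    (ha : a ∉ arc x₀ m) : a = x₀ + m ∨ a = x₀ - 1 := by
  by_cases ha1 : a + 1 ∈ arc x₀ m
  · exact Or.inr (eq_sub_of_add_eq (add_one_eq_of_notMem_arc ha ha1))
  refine Or.inl (by_contra fun hne => ?_)
  have hmn : m < n := by
    by_contra! h
    exact ha (mem_arc.2 ((ZMod.val_lt _).trans_le h))
  have ha_exit : a + 1 ∉ insert a (arc x₀ m) := by
    refine fun h => (Finset.mem_insert.1 h).elim (fun h => ?_) ha1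
    refine hS.1 (Finset.eq_univ_iff_forall.2
      (zmod_forall_of_succ (Finset.mem_insert_self a _) fun x _ => ?_))
    rw [left_eq_add.1 h.symm, add_zero]
    assumption
  obtain ⟨l, rfl⟩ : ∃ l, m = l + 1 := ⟨m - 1, by omega⟩
  have hl : x₀ + (l : ZMod n) ∈ arc x₀ (l + 1) := by
    rw [arc_succ (by omega)]; exact Finset.mem_insert_self _ _
  have hl_exit : x₀ + (l : ZMod n) + 1 ∉ insert a (arc x₀ (l + 1)) := by
    have hend : x₀ + (l : ZMod n) + 1 = x₀ + ((l + 1 : ℕ) : ZMod n) := by push_cast; ring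
    rw [hend, Finset.mem_insert, not_or]
    exact ⟨Ne.symm hne, add_natCast_notMem_arc hmn⟩
  exact ha (hS.eq_of_add_one_notMem (Finset.mem_insert_self _ _) ha_exit
    (Finset.mem_insert_of_mem hl) hl_exit ▸ hl)

end Arcs

/-! ### The isoperimetric inequality -/

section Transpose

/-- The reflection of a set of vertices at the diagonal, which exchanges rows and columns. -/
def transpose (A : Finset (Vertex K L)) : Finset (Vertex L K) :=
  A.map (Equiv.prodComm _ _).toEmbedding

variable {A : Finset (Vertex K L)} {v : Vertex K L}

@[simp]
theorem mem_transpose {w : Vertex L K} : w ∈ transpose A ↔ w.swap ∈ A := by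
  simp only [transpose, Finset.mem_map_equiv]
  rfl

@[simp]
theorem transpose_transpose (A : Finset (Vertex K L)) : transpose (transpose A) = A := by
  ext; simp

@[simp]
theorem card_transpose (A : Finset (Vertex K L)) : (transpose A).card = A.card :=
  Finset.card_map _

theorem transpose_insert : transpose (insert v A) = insert v.swap (transpose A) :=
  Finset.map_insert _ _ _

theorem image_fst_transpose (A : Finset (Vertex K L)) :
    (transpose A).image Prod.fst = A.image Prod.snd := by
  ext; simp

theorem image_snd_transpose (A : Finset (Vertex K L)) :
    (transpose A).image Prod.snd = A.image Prod.fst := by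
  ext; simp

theorem card_exits_snd (A : Finset (Vertex K L)) :
    (exits (0, 1) A).card = (exits (1, 0) (transpose A)).card := by
  rw [← card_transpose]
  congr 1
  ext ⟨y, x⟩
  simp [mem_exits]

/-- The number of exits in the two directions: half of the length of the boundary. -/
def halfPerimeter (A : Finset (Vertex K L)) : ℕ := (exits (1, 0) A).card + (exits (0, 1) A).card

theorem halfPerimeter_transpose (A : Finset (Vertex K L)) :
    halfPerimeter (transpose A) = halfPerimeter A := by
  rw [halfPerimeter, halfPerimeter, card_exits_snd, card_exits_snd, transpose_transpose, add_comm]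

end Transpose

section Rows

variable [NeZero K] {l : ℕ} {A : Finset (Vertex K L)} {x : ZMod K} {y : ZMod L}

/-- The points of `A` with second coordinate `y`, as a set of first coordinates. -/
def row (A : Finset (Vertex K L)) (y : ZMod L) : Finset (ZMod K) :=
  Finset.univ.filter fun x => (x, y) ∈ A

@[simp]
theorem mem_row : x ∈ row A y ↔ (x, y) ∈ A := by simp [row]

theorem row_nonempty_iff : (row A y).Nonempty ↔ y ∈ A.image Prod.snd := by
  simp [Finset.Nonempty]

variable [NeZero L]

theorem card_exits_fst (A : Finset (Vertex K L)) :
    (exits (1, 0) A).card = ∑ y, (exits 1 (row A y)).card := by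
  rw [Finset.card_eq_sum_card_fiberwise (f := Prod.snd) (t := Finset.univ) (by simp)]
  refine Finset.sum_congr rfl fun y _ =>
    Finset.card_bij' (fun w _ => w.1) (fun x _ => (x, y)) ?_ ?_ ?_ ?_
  · rintro ⟨x, _⟩ hx
    obtain ⟨hexit, rfl⟩ := Finset.mem_filter.1 hx
    simpa [mem_exits] using hexit
  · intro x hx
    simpa [mem_exits] using hx
  · rintro ⟨x, _⟩ hx
    obtain ⟨-, rfl⟩ := Finset.mem_filter.1 hx
    rfl
  · simp

theorem boole_le_card_exits_one {n : ℕ} [NeZero n] (S : Finset (ZMod n)) :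
    (if S.Nonempty ∧ S ≠ Finset.univ then 1 else 0) ≤ (exits 1 S).card := by
  split_ifs with h
  · exact Finset.card_pos.2 (exits_one_nonempty h.1 h.2)
  · exact Nat.zero_le _

theorem card_proper_rows_le (A : Finset (Vertex K L)) :
    (Finset.univ.filter fun y => (row A y).Nonempty ∧ row A y ≠ Finset.univ).card ≤
      (exits (1, 0) A).card := by
  rw [Finset.card_filter, card_exits_fst]
  exact Finset.sum_le_sum fun y _ => boole_le_card_exits_one (row A y)

theorem row_ne_univ (hl : 0 < l) (hK : 3 * l ≤ K) (hL : 3 * l ≤ L) (hA : A.card ≤ l ^ 2)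
    (hper : halfPerimeter A ≤ 2 * l) (y : ZMod L) : row A y ≠ Finset.univ := by
  intro hrow
  have hcolumns (x : ZMod K) : (row (transpose A) x).Nonempty :=
    ⟨y, by simpa using mem_row.1 (hrow ▸ Finset.mem_univ x)⟩
  have hproper := card_proper_rows_le (transpose A)
  simp only [hcolumns, true_and] at hproper
  have hsplit := Finset.card_filter_add_card_filter_not (s := (Finset.univ : Finset (ZMod K)))
    fun x => row (transpose A) x ≠ Finset.univ
  rw [Finset.card_univ, ZMod.card] at hsplit
  set F := Finset.univ.filter fun x : ZMod K => ¬ row (transpose A) x ≠ Finset.univ with hF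
  have hfull : F ×ˢ (Finset.univ : Finset (ZMod L)) ⊆ A := by
    rintro ⟨x, z⟩ hx
    have hcolumn : row (transpose A) x = Finset.univ := by simpa [hF] using hx
    have hz : z ∈ row (transpose A) x := hcolumn ▸ Finset.mem_univ z
    simpa using hz
  have hcard := Finset.card_le_card hfull
  rw [Finset.card_product, Finset.card_univ, ZMod.card] at hcard
  have hFl : l ≤ F.card := by
    rw [halfPerimeter, card_exits_snd] at hper
    omega
  nlinarith [Nat.mul_le_mul hFl hL]

theorem card_image_snd_le (hA : ∀ y, row A y ≠ Finset.univ) :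
    (A.image Prod.snd).card ≤ (exits (1, 0) A).card := by
  refine le_trans (Finset.card_le_card fun y hy => ?_) (card_proper_rows_le A)
  simpa [hA y, row_nonempty_iff] using hy

theorem isArc_row (hA : ∀ y, row A y ≠ Finset.univ)
    (hcard : (exits (1, 0) A).card ≤ (A.image Prod.snd).card) (y : ZMod L) : IsArc (row A y) := by
  have hrows : A.image Prod.snd =
      Finset.univ.filter fun y => (row A y).Nonempty ∧ row A y ≠ Finset.univ := by
    ext y
    simp only [hA, row_nonempty_iff, Finset.mem_filter, Finset.mem_univ, true_and, ne_eq,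
      not_false_eq_true, and_true]
  rw [card_exits_fst, hrows, Finset.card_filter] at hcard
  have heq := (Finset.sum_eq_sum_iff_of_le fun y _ => boole_le_card_exits_one (row A y)).1
    (le_antisymm (Finset.sum_le_sum fun y _ => boole_le_card_exits_one (row A y)) hcard) y
    (Finset.mem_univ y)
  refine ⟨hA y, heq ▸ ?_⟩
  split_ifs <;> simp

/-- Every row and every column is a proper cyclic interval. -/
structure IsHVConvex (A : Finset (Vertex K L)) : Prop where
  isArc_row (y : ZMod L) : IsArc (row A y)
  isArc_column (x : ZMod K) : IsArc (row (transpose A) x)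

protected theorem IsHVConvex.transpose (hA : IsHVConvex A) : IsHVConvex (transpose A) :=
  ⟨hA.isArc_column, by simpa using hA.isArc_row⟩

theorem card_image_add_le (hl : 0 < l) (hK : 3 * l ≤ K) (hL : 3 * l ≤ L) (hA : A.card ≤ l ^ 2)
    (hper : halfPerimeter A ≤ 2 * l) :
    (A.image Prod.fst).card + (A.image Prod.snd).card ≤ halfPerimeter A := by
  have hrows := card_image_snd_le (row_ne_univ hl hK hL hA hper)
  have hcolumns := card_image_snd_le (row_ne_univ (A := transpose A) hl hL hK
    (by rwa [card_transpose]) (by rwa [halfPerimeter_transpose]))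
  rw [image_snd_transpose, ← card_exits_snd] at hcolumns
  rw [halfPerimeter]
  omega

theorem isHVConvex_of_halfPerimeter_le (hl : 0 < l) (hK : 3 * l ≤ K) (hL : 3 * l ≤ L)
    (hA : A.card ≤ l ^ 2) (hper : halfPerimeter A ≤ 2 * l)
    (hle : halfPerimeter A ≤ (A.image Prod.fst).card + (A.image Prod.snd).card) :
    IsHVConvex A := by
  have hrow := row_ne_univ hl hK hL hA hper
  have hcolumn := row_ne_univ (A := transpose A) hl hL hK (by rwa [card_transpose])
    (by rwa [halfPerimeter_transpose])
  have hrows := card_image_snd_le hrow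
  have hcolumns := card_image_snd_le hcolumn
  rw [image_snd_transpose] at hcolumns
  rw [halfPerimeter, card_exits_snd] at hle
  exact ⟨isArc_row hrow (by omega), isArc_row hcolumn (by rw [image_snd_transpose]; omega)⟩

theorem IsHVConvex.eq_of_mem {T : Type*} {f : Vertex K L → T} {a : ZMod K} {b : ZMod L}
    (hA : IsHVConvex A) (hf : ∀ w ∈ A, w + (1, 0) ∈ A → f w = f (w + (1, 0)))
    (hf' : ∀ w ∈ A, w + (0, 1) ∈ A → f w = f (w + (0, 1))) (hab : (a, b) ∈ A)
    (hb : ∀ x y, (x, y) ∈ A → (x, b) ∈ A) : ∀ w ∈ A, f w = f (a, b) := by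
  rintro ⟨x, y⟩ hxy
  have hxb := hb x y hxy
  calc f (x, y) = f (x, b) := eq_of_card_exits_le_one (hA.isArc_column x).2
        (f := fun y => f (x, y))
        (fun z hz hz' => by simpa using hf' (x, z) (by simpa using hz) (by simpa using hz'))
        (by simpa using hxy) (by simpa using hxb)
    _ = f (a, b) := eq_of_card_exits_le_one (hA.isArc_row b).2 (f := fun x => f (x, b))
        (fun z hz hz' => by simpa using hf (z, b) (by simpa using hz) (by simpa using hz'))
        (by simpa using hxb) (by simpa using hab)

end Rows

section Isoperimetry

variable {k : ℕ} {A B : Finset (Vertex K L)}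

theorem card_le_card_image_mul : A.card ≤ (A.image Prod.fst).card * (A.image Prod.snd).card := by
  rw [← Finset.card_product]
  exact Finset.card_le_card Finset.subset_product

theorem eq_image_product (hA : (A.image Prod.fst).card * (A.image Prod.snd).card ≤ A.card) :
    A = A.image Prod.fst ×ˢ A.image Prod.snd :=
  Finset.eq_of_subset_of_card_le Finset.subset_product (by rwa [Finset.card_product])

theorem two_mul_succ_le_add_of_lt_mul {a b : ℕ} (h : k * (k + 1) < a * b) :
    2 * (k + 1) ≤ a + b := by
  by_contra! hlt
  have hsum : (a + b) ^ 2 ≤ (2 * k + 1) ^ 2 := Nat.pow_le_pow_left (by omega) 2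
  zify at *
  nlinarith [sq_nonneg ((a : ℤ) - b)]

theorem eq_or_eq_of_le_mul_of_add_le {a b : ℕ} (hk : 1 ≤ k) (h : k * (k + 1) ≤ a * b)
    (hab : a + b ≤ 2 * k + 1) :
    (a = k ∧ b = k + 1) ∨ (a = k + 1 ∧ b = k) := by
  have ha : a = k ∨ a = k + 1 := by
    by_contra! hne
    rcases lt_or_ge a k with hlt | hge
    · nlinarith
    · have hgt : k + 1 < a := by omega
      nlinarith
  rcases ha with rfl | rfl
  · exact Or.inl ⟨rfl, by nlinarith⟩
  · exact Or.inr ⟨rfl, by nlinarith⟩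

/-- The smallest box that contains `A` is a square of side length `l`, where the side lengths of
the box count the rows and the columns that meet `A`. -/
def HasSquareBox (A : Finset (Vertex K L)) (l : ℕ) : Prop :=
  (A.image Prod.fst).card = l ∧ (A.image Prod.snd).card = l

protected theorem HasSquareBox.transpose {l : ℕ} (hA : HasSquareBox A l) :
    HasSquareBox (transpose A) l := by
  rw [HasSquareBox, image_fst_transpose, image_snd_transpose]
  exact hA.symm

variable [NeZero K] [NeZero L]

theorem two_mul_le_halfPerimeter (hK : 3 * (k + 1) ≤ K) (hL : 3 * (k + 1) ≤ L)
    (hA : k * (k + 1) < A.card) (hA' : A.card ≤ (k + 1) ^ 2) :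
    2 * (k + 1) ≤ halfPerimeter A := by
  by_contra! hlt
  have hbox := card_image_add_le k.succ_pos hK hL hA' hlt.le
  have harea := two_mul_succ_le_add_of_lt_mul (hA.trans_le card_le_card_image_mul)
  omega

theorem card_image_add_eq (hK : 3 * (k + 1) ≤ K) (hL : 3 * (k + 1) ≤ L)
    (hA : k * (k + 1) < A.card) (hA' : A.card ≤ (k + 1) ^ 2)
    (hper : halfPerimeter A ≤ 2 * (k + 1)) :
    (A.image Prod.fst).card + (A.image Prod.snd).card = 2 * (k + 1) :=
  le_antisymm ((card_image_add_le k.succ_pos hK hL hA' hper).trans hper)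
    (two_mul_succ_le_add_of_lt_mul (hA.trans_le card_le_card_image_mul))

theorem hasSquareBox_of_card_eq (hk : 1 ≤ k) (hK : 3 * (k + 1) ≤ K) (hL : 3 * (k + 1) ≤ L)
    (hA : A.card = (k + 1) ^ 2) (hper : halfPerimeter A ≤ 2 * (k + 1)) :
    HasSquareBox A (k + 1) := by
  have hsum := card_image_add_eq hK hL (by rw [hA]; nlinarith) hA.le hper
  have hprod := card_le_card_image_mul (A := A)
  rw [hA] at hprod
  have hfst : (A.image Prod.fst).card = k + 1 := by
    zify at *
    nlinarith [sq_nonneg (((A.image Prod.fst).card : ℤ) - (k + 1))]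
  exact ⟨hfst, by omega⟩

theorem hasSquareBox_iff_of_subset (hK : 3 * (k + 1) ≤ K) (hL : 3 * (k + 1) ≤ L) (hAB : A ⊆ B)
    (hA : k * (k + 1) < A.card) (hB : B.card ≤ (k + 1) ^ 2)
    (hperA : halfPerimeter A ≤ 2 * (k + 1)) (hperB : halfPerimeter B ≤ 2 * (k + 1)) :
    HasSquareBox A (k + 1) ↔ HasSquareBox B (k + 1) := by
  have hcard := Finset.card_le_card hAB
  have hsumA := card_image_add_eq hK hL hA (hcard.trans hB) hperA
  have hsumB := card_image_add_eq hK hL (hA.trans_le hcard) hB hperB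
  have hfst := Finset.card_le_card (Finset.image_subset_image (f := Prod.fst) hAB)
  have hsnd := Finset.card_le_card (Finset.image_subset_image (f := Prod.snd) hAB)
  unfold HasSquareBox
  omega

end Isoperimetry

section Rectangles

variable {k m n : ℕ} {x₀ : ZMod K} {y₀ : ZMod L} {v : Vertex K L}

theorem rectangle_one_one (v : Vertex K L) : rectangle v 1 1 = {v} := by
  ext ⟨x, y⟩
  simp [rectangle, ZMod.val_eq_zero, sub_eq_zero, Prod.ext_iff]

theorem preimage_swap_rectangle (v : Vertex K L) (m n : ℕ) :
    Prod.swap ⁻¹' rectangle v m n = rectangle v.swap n m := by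
  ext
  simp [rectangle, and_comm]

theorem preimage_swap_mem_rectanglesWithBar {a b l : ℕ} {R : Set (Vertex K L)}
    (hR : R ∈ rectanglesWithBar K L a b l) :
    Prod.swap ⁻¹' R ∈ rectanglesWithBar L K a b l := by
  obtain ⟨v₀, c, hc, hR⟩ := hR
  refine ⟨v₀.swap, c, hc, ?_⟩
  rcases hR with rfl | rfl | rfl | rfl <;>
    simp [preimage_swap_rectangle]

variable [NeZero K] [NeZero L] {P : Finset (ZMod K)} {Q : Finset (ZMod L)} {a : ZMod K}
  {b : ZMod L} {A : Finset (Vertex K L)}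

theorem coe_arc_product (x₀ : ZMod K) (y₀ : ZMod L) (m n : ℕ) :
    (↑(arc x₀ m ×ˢ arc y₀ n) : Set (Vertex K L)) = rectangle (x₀, y₀) m n := by
  ext
  simp [rectangle, mem_arc]

theorem insert_arc_product_mem_rectanglesWithBar (ha : a = x₀ + m ∨ a = x₀ - 1)
    (hb : b ∈ arc y₀ n) :
    (↑(insert (a, b) (arc x₀ m ×ˢ arc y₀ n)) : Set (Vertex K L)) ∈
      rectanglesWithBar K L m n 1 := by
  refine ⟨(x₀, y₀), (b - y₀).val, mem_arc.1 hb, ?_⟩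
  rw [Finset.coe_insert, coe_arc_product, Set.insert_eq, Set.union_comm]
  simp only [rectangle_one_one, Prod.mk_add_mk, ZMod.natCast_zmod_val, add_sub_cancel]
  rcases ha with rfl | rfl
  · exact Or.inl rfl
  · exact Or.inr (Or.inl (by rw [sub_eq_add_neg]))

theorem IsHVConvex.insert_product_mem_rectanglesWithBar
    (hconvex : IsHVConvex (insert (a, b) (P ×ˢ Q))) (hP : P.Nonempty) (hQ : 2 ≤ Q.card)
    (ha : a ∉ P) (hb : b ∈ Q) :
    (↑(insert (a, b) (P ×ˢ Q)) : Set (Vertex K L)) ∈ rectanglesWithBar K L P.card Q.card 1 := by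
  obtain ⟨x, hx⟩ := hP
  obtain ⟨y, hy, hyb⟩ := Finset.exists_mem_ne hQ b
  have hcolumn : row (transpose (insert (a, b) (P ×ˢ Q))) x = Q := by
    ext z
    have hxa : x ≠ a := fun h => ha (h ▸ hx)
    simp [hx, hxa]
  have hrow : row (insert (a, b) (P ×ˢ Q)) y = P := by ext; simp [hy, hyb]
  have hrow_b : row (insert (a, b) (P ×ˢ Q)) b = insert a P := by ext; simp [hb]
  obtain ⟨x₀, hParc⟩ := (hrow ▸ hconvex.isArc_row y).exists_eq_arc ⟨x, hx⟩
  obtain ⟨y₀, hQarc⟩ := (hcolumn ▸ hconvex.isArc_column x).exists_eq_arc ⟨b, hb⟩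
  have hside : a = x₀ + P.card ∨ a = x₀ - 1 :=
    IsArc.eq_or_eq_of_insert (hParc ▸ hrow_b ▸ hconvex.isArc_row b)
      (Finset.card_pos.2 ⟨x, hx⟩) (hParc ▸ ha)
  have hmem := insert_arc_product_mem_rectanglesWithBar hside (hQarc ▸ hb)
  rwa [← hParc, ← hQarc] at hmem

theorem IsHVConvex.insert_mem_rectanglesWithBar_of_card_image {T : Type*} {f : Vertex K L → T}
    (hk : 1 ≤ k) (hconvex : IsHVConvex (insert v A)) (hbox : HasSquareBox (insert v A) (k + 1))
    (hA : A = A.image Prod.fst ×ˢ A.image Prod.snd) (hfst : (A.image Prod.fst).card = k)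
    (hsnd : (A.image Prod.snd).card = k + 1)
    (hf : ∀ w ∈ insert v A, w + (1, 0) ∈ insert v A → f w = f (w + (1, 0)))
    (hf' : ∀ w ∈ insert v A, w + (0, 1) ∈ insert v A → f w = f (w + (0, 1))) :
    (↑(insert v A) : Set (Vertex K L)) ∈ rectanglesWithBar K L k (k + 1) 1 ∧
      ∀ w ∈ insert v A, f w = f v := by
  obtain ⟨a, b⟩ := v
  obtain ⟨hbox_fst, hbox_snd⟩ := hbox
  rw [Finset.image_insert] at hbox_fst hbox_snd
  set P := A.image Prod.fst
  set Q := A.image Prod.snd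
  have ha : a ∉ P := fun h => by
    rw [Finset.insert_eq_of_mem h] at hbox_fst
    omega
  have hb : b ∈ Q := by
    by_contra h
    rw [Finset.card_insert_of_notMem h] at hbox_snd
    omega
  constructor
  · have hmem := IsHVConvex.insert_product_mem_rectanglesWithBar (hA ▸ hconvex)
      (Finset.card_pos.1 (by omega)) (by omega) ha hb
    rwa [← hA, hfst, hsnd] at hmem
  · refine hconvex.eq_of_mem hf hf' (Finset.mem_insert_self _ _) fun x y hxy => ?_
    rw [hA, Finset.mem_insert, Finset.mem_product, Prod.mk.injEq] at hxy ⊢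
    exact hxy.imp (fun h => ⟨h.1, rfl⟩) fun h => ⟨h.1, hb⟩

theorem insert_mem_rectanglesWithBar {T : Type*} {f : Vertex K L → T} (hk : 1 ≤ k)
    (hK : 3 * (k + 1) ≤ K) (hL : 3 * (k + 1) ≤ L) (hcard : A.card = k * (k + 1))
    (hper : halfPerimeter A ≤ 2 * k + 1) (hv : v ∉ A)
    (hper' : halfPerimeter (insert v A) ≤ 2 * (k + 1)) (hbox : HasSquareBox (insert v A) (k + 1))
    (hf : ∀ w ∈ insert v A, w + (1, 0) ∈ insert v A → f w = f (w + (1, 0)))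
    (hf' : ∀ w ∈ insert v A, w + (0, 1) ∈ insert v A → f w = f (w + (0, 1))) :
    (↑(insert v A) : Set (Vertex K L)) ∈ rectanglesWithBar K L k (k + 1) 1 ∧
      ∀ w ∈ insert v A, f w = f v := by
  have hconvex : IsHVConvex (insert v A) := by
    refine isHVConvex_of_halfPerimeter_le k.succ_pos hK hL ?_ hper' ?_
    · rw [Finset.card_insert_of_notMem hv, hcard]
      nlinarith
    · rw [hbox.1, hbox.2]
      omega
  have hsum := card_image_add_le k.succ_pos hK hL (by rw [hcard]; nlinarith) (by omega)
  rcases eq_or_eq_of_le_mul_of_add_le hk (hcard ▸ card_le_card_image_mul) (hsum.trans hper) with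
    ⟨hfst, hsnd⟩ | ⟨hfst, hsnd⟩
  · exact hconvex.insert_mem_rectanglesWithBar_of_card_image hk hbox
      (eq_image_product (by rw [hfst, hsnd, hcard])) hfst hsnd hf hf'
  · have hA := eq_image_product (A := transpose A) (by
      rw [image_fst_transpose, image_snd_transpose, hfst, hsnd, card_transpose, hcard])
    have hconvex' := hconvex.transpose
    have hbox' := hbox.transpose
    rw [transpose_insert] at hconvex' hbox'
    obtain ⟨hmem, hconst⟩ := hconvex'.insert_mem_rectanglesWithBar_of_card_image
      (f := f ∘ Prod.swap) hk hbox' hA (by rwa [image_fst_transpose])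
      (by rwa [image_snd_transpose])
      (fun w hw hw' => hf' w.swap (by simpa [← transpose_insert] using hw)
        (by simpa [← transpose_insert] using hw'))
      (fun w hw hw' => hf w.swap (by simpa [← transpose_insert] using hw)
        (by simpa [← transpose_insert] using hw'))
    rw [← transpose_insert] at hmem hconst
    refine ⟨?_, fun w hw => by simpa using hconst w.swap (by simpa using hw)⟩
    convert preimage_swap_mem_rectanglesWithBar hmem
    ext
    simp

end Rectangles

/-! ### Crossing the critical area -/

section Saddle

variable {k : ℕ} {h : ℝ}

/-- The energy barrier between the configuration `1` and the stable states, where `k + 1` is the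
critical length: the critical droplets have perimeter `4 (k + 1)` and area `k (k + 1) + 1`. -/
def barrier (k : ℕ) (h : ℝ) : ℝ := 4 * (k + 1) - h * (k * (k + 1) + 1)

/-- The energy of the critical configurations: the energy of the configuration `1` plus the
barrier. -/
def saddleEnergy (K L k : ℕ) (h : ℝ) : ℝ := -2 * (K * L) + h * (K * L) + barrier k h

theorem exists_criticalLength_eq (h_pos : 0 < h) (h_lt : h < 1) (h_int : ∀ n : ℤ, 2 / h ≠ n) :
    ∃ k : ℕ, criticalLength h = k + 1 ∧ 2 ≤ k ∧ h * k < 2 ∧ 2 < h * (k + 1) := by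
  have htwo : 2 < 2 / h := by rw [lt_div_iff₀ h_pos]; linarith
  have hlt : 2 / h < criticalLength h :=
    lt_of_le_of_ne (Nat.le_ceil _) (by exact_mod_cast h_int (criticalLength h))
  have hgt : (criticalLength h : ℝ) < 2 / h + 1 := Nat.ceil_lt_add_one (by linarith)
  have hthree : 2 < criticalLength h := by exact_mod_cast htwo.trans hlt
  obtain ⟨k, hk⟩ : ∃ k, criticalLength h = k + 1 := ⟨criticalLength h - 1, by omega⟩
  rw [hk] at hlt hgt hthree
  push_cast at hlt hgt
  rw [div_lt_iff₀ h_pos] at hlt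
  rw [add_lt_add_iff_right, lt_div_iff₀ h_pos] at hgt
  exact ⟨k, hk, by omega, by linarith, by linarith⟩

variable [NeZero K] [NeZero L] [NeZero q] {σ σ' : Config K L q}

theorem two_mul_halfPerimeter_le_wall (σ : Config K L q) :
    2 * halfPerimeter (nonOne σ) ≤ wall σ := by
  rw [wall, halfPerimeter, disagreements_eq_two_mul_card_exits_add (1, 0) σ fun _ => mem_nonOne,
    disagreements_eq_two_mul_card_exits_add (0, 1) σ fun _ => mem_nonOne]
  omega

theorem eq_add_of_wall_le (hσ : wall σ ≤ 2 * halfPerimeter (nonOne σ)) {e : Vertex K L}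
    (he : e = (1, 0) ∨ e = (0, 1)) (w : Vertex K L) (hw : w ∈ nonOne σ)
    (hwe : w + e ∈ nonOne σ) : σ w = σ (w + e) := by
  have hge (e : Vertex K L) : 2 * (exits e (nonOne σ)).card ≤ disagreements e σ := by
    rw [disagreements_eq_two_mul_card_exits_add e σ fun _ => mem_nonOne]
    omega
  have hle : disagreements e σ ≤ 2 * (exits e (nonOne σ)).card := by
    have hfst := hge (1, 0)
    have hsnd := hge (0, 1)
    rw [wall, halfPerimeter] at hσ
    rcases he with rfl | rfl <;> omega
  rw [disagreements_eq_two_mul_card_exits_add e σ fun _ => mem_nonOne, add_le_iff_nonpos_right,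
    nonpos_iff_eq_zero, Finset.card_eq_zero, Finset.filter_eq_empty_iff] at hle
  exact by_contra fun hne => hle (Finset.mem_univ w) ⟨hw, hwe, hne⟩

theorem wall_le_of_energy_le (hK : 3 ≤ K) (hL : 3 ≤ L)
    (hσ : energy h σ ≤ saddleEnergy K L k h) :
    (wall σ : ℝ) ≤ 4 * (k + 1) + h * (nonOne σ).card - h * (k * (k + 1) + 1) := by
  rw [energy_eq hK hL, saddleEnergy, barrier] at hσ
  linarith

theorem halfPerimeter_le_of_card_eq (h_pos : 0 < h) (hK : 3 ≤ K) (hL : 3 ≤ L)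
    (hσ : energy h σ ≤ saddleEnergy K L k h) (hcard : (nonOne σ).card = k * (k + 1)) :
    halfPerimeter (nonOne σ) ≤ 2 * k + 1 := by
  have hwall := wall_le_of_energy_le hK hL hσ
  rw [hcard] at hwall
  push_cast at hwall
  have hlt : wall σ < 4 * (k + 1) := by
    rw [← Nat.cast_lt (α := ℝ)]
    push_cast
    linarith
  have hper := two_mul_halfPerimeter_le_wall σ
  omega

theorem halfPerimeter_le_of_card_le (h_pos : 0 < h) (hk : h * k < 2) (hK : 3 ≤ K) (hL : 3 ≤ L)
    (hσ : energy h σ ≤ saddleEnergy K L k h) (hcard : (nonOne σ).card ≤ (k + 1) ^ 2) :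
    halfPerimeter (nonOne σ) ≤ 2 * (k + 1) := by
  have hwall := wall_le_of_energy_le hK hL hσ
  have hcard' : ((nonOne σ).card : ℝ) ≤ (k + 1) ^ 2 := by exact_mod_cast hcard
  have hlt : wall σ < 4 * (k + 1) + 2 := by
    rw [← Nat.cast_lt (α := ℝ)]
    push_cast
    nlinarith [mul_le_mul_of_nonneg_left hcard' h_pos.le]
  have hper := two_mul_halfPerimeter_le_wall σ
  omega

theorem nonOne_of_connectivity_pos (hc : 0 < connectivity σ σ') :
    nonOne σ' = nonOne σ ∨ (∃ v, v ∉ nonOne σ ∧ nonOne σ' = insert v (nonOne σ)) ∨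
      (∃ v, v ∉ nonOne σ' ∧ nonOne σ = insert v (nonOne σ')) := by
  obtain ⟨v, hv⟩ := exists_update_of_connectivity_pos hc
  have herase : (nonOne σ').erase v = (nonOne σ).erase v := by
    ext w
    simp only [Finset.mem_erase, mem_nonOne]
    exact and_congr_right fun hw => by rw [hv w hw]
  by_cases hσ : v ∈ nonOne σ <;> by_cases hσ' : v ∈ nonOne σ'
  · exact Or.inl (by rw [← Finset.insert_erase hσ', herase, Finset.insert_erase hσ])
  · refine Or.inr (Or.inr ⟨v, hσ', ?_⟩)
    rw [← Finset.erase_eq_of_notMem hσ', herase, Finset.insert_erase hσ]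
  · refine Or.inr (Or.inl ⟨v, hσ, ?_⟩)
    rw [← Finset.erase_eq_of_notMem hσ, ← herase, Finset.insert_erase hσ']
  · refine Or.inl ?_
    rw [← Finset.erase_eq_of_notMem hσ, ← herase, Finset.erase_eq_of_notMem hσ']

/-- The configurations with at most `(k + 1) ^ 2` spins that are not `1` and that are not yet on
the way from a rectangle `k × (k + 1)` to a square `(k + 1) × (k + 1)`. A rectangle `k × (k + 1)`
with a protuberance at one of its shortest sides belongs to them: its energy is critical, but it is
a dead end. -/
def subcritical (K L q k : ℕ) [NeZero K] [NeZero L] [NeZero q] : Set (Config K L q) :=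
  {σ | (nonOne σ).card ≤ k * (k + 1) ∨
    ((nonOne σ).card ≤ (k + 1) ^ 2 ∧ ¬ HasSquareBox (nonOne σ) (k + 1))}

theorem mem_criticalSet_of_crossing (hcrit : criticalLength h = k + 1) (hk1 : 1 ≤ k)
    (h_pos : 0 < h) (hk : h * k < 2) (hK : 3 * (k + 1) ≤ K) (hL : 3 * (k + 1) ≤ L)
    {v : Vertex K L} (hv : v ∉ nonOne σ) (hinsert : nonOne σ' = insert v (nonOne σ))
    (hcard : (nonOne σ).card = k * (k + 1)) (hσ : energy h σ ≤ saddleEnergy K L k h)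
    (hσ' : energy h σ' ≤ saddleEnergy K L k h) (hbox : HasSquareBox (nonOne σ') (k + 1)) :
    σ' ∈ criticalSet K L q h := by
  have hcard' : (nonOne σ').card = k * (k + 1) + 1 := by
    rw [hinsert, Finset.card_insert_of_notMem hv, hcard]
  have hle : (nonOne σ').card ≤ (k + 1) ^ 2 := by rw [hcard']; nlinarith
  have hper := halfPerimeter_le_of_card_eq h_pos (by omega) (by omega) hσ hcard
  have hper' := halfPerimeter_le_of_card_le h_pos hk (by omega) (by omega) hσ' hle
  have hwall : wall σ' ≤ 2 * halfPerimeter (nonOne σ') := by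
    have hlow := two_mul_le_halfPerimeter hK hL (by omega) hle
    have hwall := wall_le_of_energy_le (by omega) (by omega) hσ'
    rw [hcard'] at hwall
    push_cast at hwall
    have hwall' : wall σ' ≤ 4 * (k + 1) := by
      rw [← Nat.cast_le (α := ℝ)]
      push_cast
      linarith
    omega
  have hfst := eq_add_of_wall_le hwall (Or.inl rfl)
  have hsnd := eq_add_of_wall_le hwall (Or.inr rfl)
  rw [hinsert] at hper' hbox hfst hsnd
  obtain ⟨hR, hconst⟩ := insert_mem_rectanglesWithBar hk1 hK hL hcard hper hv hper' hbox hfst hsnd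
  rw [← hinsert] at hR hconst
  refine Set.mem_biUnion (x := σ' v)
    (mem_nonOne.1 (hinsert ▸ Finset.mem_insert_self v (nonOne σ))) ?_
  rw [hcrit, Nat.add_sub_cancel]
  refine ⟨_, hR, fun w => ⟨fun hw => hconst w hw, fun hw => ?_⟩⟩
  simpa [mem_nonOne] using hw

theorem subcritical_step (hcrit : criticalLength h = k + 1) (hk1 : 1 ≤ k) (h_pos : 0 < h)
    (hk : h * k < 2) (hK : 3 * (k + 1) ≤ K) (hL : 3 * (k + 1) ≤ L)
    (hσ : energy h σ ≤ saddleEnergy K L k h) (hσ' : energy h σ' ≤ saddleEnergy K L k h)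
    (hc : 0 < connectivity σ σ') (hsub : σ ∈ subcritical K L q k)
    (hcritical : σ' ∉ criticalSet K L q h) : σ' ∈ subcritical K L q k := by
  have hper {τ : Config K L q} (hτ : energy h τ ≤ saddleEnergy K L k h)
      (hcard : (nonOne τ).card ≤ (k + 1) ^ 2) : halfPerimeter (nonOne τ) ≤ 2 * (k + 1) :=
    halfPerimeter_le_of_card_le h_pos hk (by omega) (by omega) hτ hcard
  by_cases hlow' : (nonOne σ').card ≤ k * (k + 1)
  · exact Or.inl hlow'
  right
  rcases nonOne_of_connectivity_pos hc with heq | ⟨v, hv, hinsert⟩ | ⟨v, hv, hinsert⟩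
  · rw [heq] at hlow' ⊢
    exact hsub.resolve_left hlow'
  · have hcard' : (nonOne σ').card = (nonOne σ).card + 1 := by
      rw [hinsert, Finset.card_insert_of_notMem hv]
    by_cases hlow : (nonOne σ).card ≤ k * (k + 1)
    · refine ⟨by nlinarith, fun hbox => hcritical ?_⟩
      exact mem_criticalSet_of_crossing hcrit hk1 h_pos hk hK hL hv hinsert (by omega) hσ hσ' hbox
    · obtain ⟨hle, hbox⟩ := hsub.resolve_left hlow
      have hne : (nonOne σ).card ≠ (k + 1) ^ 2 := fun hcard =>
        hbox (hasSquareBox_of_card_eq hk1 hK hL hcard (hper hσ hle))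
      have hle' : (nonOne σ').card ≤ (k + 1) ^ 2 := by omega
      exact ⟨hle', fun hbox' => hbox ((hasSquareBox_iff_of_subset hK hL
        (hinsert ▸ Finset.subset_insert _ _) (not_le.1 hlow) hle' (hper hσ hle)
        (hper hσ' hle')).2 hbox')⟩
  · have hcard' : (nonOne σ).card = (nonOne σ').card + 1 := by
      rw [hinsert, Finset.card_insert_of_notMem hv]
    obtain ⟨hle, hbox⟩ := hsub.resolve_left (by omega)
    have hle' : (nonOne σ').card ≤ (k + 1) ^ 2 := by omega
    exact ⟨hle', fun hbox' => hbox ((hasSquareBox_iff_of_subset hK hL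
      (hinsert ▸ Finset.subset_insert _ _) (not_le.1 hlow') hle (hper hσ' hle')
      (hper hσ hle)).1 hbox')⟩

end Saddle

section StableStates

variable {k : ℕ} [NeZero K] [NeZero L] {h : ℝ}

theorem card_vertex (K L : ℕ) [NeZero K] [NeZero L] :
    (Finset.univ : Finset (Vertex K L)).card = K * L := by
  rw [Finset.card_univ, Fintype.card_prod, ZMod.card, ZMod.card]

theorem wall_const {T : Type*} [DecidableEq T] (c : T) : wall (fun _ : Vertex K L => c) = 0 := by
  simp [wall, disagreements]

theorem eq_const_of_wall_eq_zero {T : Type*} [DecidableEq T] {f : Vertex K L → T}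
    (hf : wall f = 0) : f = fun _ => f 0 := by
  simp only [wall, Nat.add_eq_zero_iff, disagreements, Finset.card_eq_zero,
    Finset.filter_eq_empty_iff, Finset.mem_univ, forall_const, not_not] at hf
  have hcolumn (x : ZMod K) : f (x, 0) = f 0 := by
    refine zmod_forall_of_succ (p := fun x => f (x, 0) = f 0) (x₀ := 0) rfl (fun x hx => ?_) x
    simpa [hx] using (@hf.1 (x, 0)).symm
  funext ⟨x, y⟩
  refine zmod_forall_of_succ (p := fun y => f (x, y) = f 0) (hcolumn x) (fun y hy => ?_) y
  simpa [hy] using (@hf.2 (x, y)).symm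

variable [NeZero q]

theorem nonOne_const {c : Spin q} (hc : c ≠ spinOne q) :
    nonOne (fun _ : Vertex K L => c) = Finset.univ := by
  ext; simp [mem_nonOne, hc]

theorem nonOne_allOne : nonOne (allOne K L q) = ∅ := by
  ext; simp [mem_nonOne, allOne]

theorem exists_spin_ne_one (hq : 1 < q) : ∃ c : Spin q, c ≠ spinOne q :=
  ⟨⟨2, Finset.mem_Icc.2 ⟨one_le_two, hq⟩⟩, by simp [spinOne]⟩

theorem exists_eq_const_of_mem_stableStates (hq : 1 < q) (h_pos : 0 < h) (hK : 3 ≤ K) (hL : 3 ≤ L)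
    {s : Config K L q} (hs : s ∈ EnergyLandscape.stableStates (energy h)) :
    ∃ c : Spin q, c ≠ spinOne q ∧ s = fun _ => c := by
  obtain ⟨c, hc⟩ := exists_spin_ne_one hq
  have henergy := hs fun _ => c
  rw [energy_eq hK hL, energy_eq hK hL, wall_const, nonOne_const hc, card_vertex] at henergy
  have hcard : (nonOne s).card ≤ K * L := card_vertex K L ▸ Finset.card_le_univ _
  have hcard_real : ((nonOne s).card : ℝ) ≤ (K * L : ℕ) := Nat.cast_le.2 hcard
  push_cast at henergy hcard_real
  have hwall : wall s = 0 := by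
    rw [← Nat.cast_eq_zero (R := ℝ)]
    nlinarith [Nat.cast_nonneg (α := ℝ) (wall s)]
  have hfull : K * L ≤ (nonOne s).card := by
    rw [← Nat.cast_le (α := ℝ)]
    push_cast
    rw [hwall] at henergy
    exact le_of_mul_le_mul_left (by push_cast at henergy; linarith) h_pos
  have huniv : nonOne s = Finset.univ :=
    Finset.eq_univ_of_card _ (by rw [← Finset.card_univ, card_vertex]; exact hcard.antisymm hfull)
  exact ⟨s 0, mem_nonOne.1 (huniv ▸ Finset.mem_univ 0), eq_const_of_wall_eq_zero hwall⟩

theorem exists_mem_criticalSet (hq : 1 < q) (hcrit : criticalLength h = k + 1) (hk1 : 1 ≤ k)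
    (h_pos : 0 < h) (hk : h * k < 2) (hK : 3 * (k + 1) ≤ K) (hL : 3 * (k + 1) ≤ L)
    {A : Set (Config K L q)} (hA : A ⊆ EnergyLandscape.stableStates (energy h))
    {ω : EnergyLandscape.Path connectivity}
    (hω : ω ∈ EnergyLandscape.paths connectivity (allOne K L q) A)
    (hheight : EnergyLandscape.height (energy h) ω ≤ saddleEnergy K L k h) :
    ∃ η ∈ criticalSet K L q h, η ∈ ω := by
  rw [EnergyLandscape.height_le_iff] at hheight
  refine EnergyLandscape.exists_mem_of_leaves (B := subcritical K L q k)
    (fun x hx y hy hsub hxy hcritical => subcritical_step hcrit hk1 h_pos hk hK hL (hheight x hx)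
      (hheight y hy) hxy hsub hcritical) ?_ ?_
  · rw [hω.1]
    exact Or.inl (by simp [nonOne_allOne])
  · obtain ⟨c, hc, hlast⟩ := exists_eq_const_of_mem_stableStates hq h_pos (by omega) (by omega)
      (hA hω.2)
    have harea := Nat.mul_le_mul hK hL
    rintro (hcard | ⟨hcard, -⟩) <;>
      rw [hlast, nonOne_const hc, card_vertex] at hcard <;> nlinarith

end StableStates

/-! ### Growth of droplets -/

section Growth

variable {m m' : ℕ} {g θ : ℝ}

/-- Growth of a set of vertices by single vertices, such that after each step twice the half
perimeter minus `g` times the area is below `θ`. -/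
def Grows (g θ : ℝ) : Finset (Vertex K L) → Finset (Vertex K L) → Prop :=
  Relation.ReflTransGen fun R R' =>
    2 * (halfPerimeter R' : ℝ) - g * R'.card < θ ∧ ∃ v ∉ R, R' = insert v R

theorem Grows.transpose {R R' : Finset (Vertex K L)} (hR : Grows g θ R R') :
    Grows g θ (transpose R) (transpose R') := by
  refine Relation.ReflTransGen.lift Potts.transpose (fun S S' hS => ?_) _ _ hR
  obtain ⟨hlt, v, hv, rfl⟩ := hS
  refine ⟨?_, v.swap, by simpa using hv, transpose_insert⟩
  rwa [halfPerimeter_transpose, card_transpose]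

theorem transpose_product (A : Finset (ZMod K)) (B : Finset (ZMod L)) :
    transpose (A ×ˢ B) = B ×ˢ A := by
  ext
  simp [and_comm]

theorem halfPerimeter_product_le {A : Finset (ZMod K)} {B : Finset (ZMod L)}
    (hA : (exits 1 A).card ≤ 1) (hB : (exits 1 B).card ≤ 1) :
    halfPerimeter (A ×ˢ B) ≤ A.card + B.card := by
  have hfst : exits ((1, 0) : Vertex K L) (A ×ˢ B) = exits 1 A ×ˢ B := by
    ext
    simp +contextual [mem_exits, and_right_comm]
  have hsnd : exits ((0, 1) : Vertex K L) (A ×ˢ B) = A ×ˢ exits 1 B := by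
    ext
    simp +contextual [mem_exits, and_assoc]
  rw [halfPerimeter, hfst, hsnd, Finset.card_product, Finset.card_product, add_comm]
  exact add_le_add (mul_le_of_le_one_right (Nat.zero_le _) hB)
    (mul_le_of_le_one_left (Nat.zero_le _) hA)

theorem product_union_insert (A : Finset (ZMod K)) (B C : Finset (ZMod L)) (x : ZMod K)
    (y : ZMod L) :
    A ×ˢ B ∪ {x} ×ˢ insert y C = insert (x, y) (A ×ˢ B ∪ {x} ×ˢ C) := by
  rw [Finset.singleton_product, Finset.singleton_product, Finset.map_insert, Finset.union_insert]
  rfl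

theorem insert_product_eq_union (A : Finset (ZMod K)) (B : Finset (ZMod L)) (x : ZMod K) :
    insert x A ×ˢ B = A ×ˢ B ∪ {x} ×ˢ B := by
  rw [Finset.insert_eq, Finset.union_product, Finset.union_comm]

section Bar

variable [NeZero L] {A : Finset (ZMod K)} {B : Finset (ZMod L)} {x : ZMod K}

theorem exists_adjacent {C : Finset (ZMod L)} (hB : (exits 1 B).card ≤ 1)
    (hC : C.Nonempty) (hCB : C ⊂ B) : ∃ y ∈ B, y ∉ C ∧ (y + 1 ∈ C ∨ y - 1 ∈ C) := by
  obtain ⟨y, hy⟩ := hC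
  obtain ⟨z, hzB, hz⟩ := Finset.exists_of_ssubset hCB
  by_contra! hnone
  refine hz ((eq_of_card_exits_le_one hB (f := (· ∈ C)) (fun x hx hx' => ?_) (hCB.1 hy) hzB).mp hy)
  refine propext ⟨fun hxC => ?_, fun hxC' => ?_⟩
  · by_contra hxC'
    exact (hnone (x + 1) hx' hxC').2 (by rwa [add_sub_cancel_right])
  · by_contra hxC
    exact (hnone x hx hxC).1 hxC'

theorem grows_union_bar (hg : 0 ≤ g) (hB : (exits 1 B).card ≤ 1) (hx : x ∉ A)
    (hxA : x + 1 ∈ A ∨ x - 1 ∈ A) {C : Finset (ZMod L)} (hC : C.Nonempty) (hCB : C ⊆ B)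
    (hθ : 2 * (halfPerimeter (A ×ˢ B ∪ {x} ×ˢ C) : ℝ) -
      g * ((A ×ˢ B ∪ {x} ×ˢ C).card + 1) < θ) :
    Grows g θ (A ×ˢ B ∪ {x} ×ˢ C) (insert x A ×ˢ B) := by
  induction hn : (B \ C).card generalizing C with
  | zero =>
    rw [Finset.card_eq_zero, Finset.sdiff_eq_empty_iff_subset] at hn
    rw [hCB.antisymm hn, insert_product_eq_union]
    exact Relation.ReflTransGen.refl
  | succ n ih =>
    have hne : C ≠ B := by rintro rfl; simp at hn
    obtain ⟨y, hyB, hyC, hy⟩ := exists_adjacent hB hC (hCB.ssubset_of_ne hne)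
    have hfst : (x, y) + (1, 0) ∈ A ×ˢ B ∪ {x} ×ˢ C ∨ (x, y) - (1, 0) ∈ A ×ˢ B ∪ {x} ×ˢ C := by
      simp only [Finset.mem_union, Finset.mem_product, Prod.mk_add_mk, Prod.mk_sub_mk, add_zero,
        sub_zero]
      exact hxA.imp (fun h => Or.inl ⟨h, hyB⟩) fun h => Or.inl ⟨h, hyB⟩
    have hsnd : (x, y) + (0, 1) ∈ A ×ˢ B ∪ {x} ×ˢ C ∨ (x, y) - (0, 1) ∈ A ×ˢ B ∪ {x} ×ˢ C := by
      simpa [hx] using hy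
    have hnotMem : (x, y) ∉ A ×ˢ B ∪ {x} ×ˢ C := by simp [hx, hyC]
    have hper := add_le_add (card_exits_insert_le hnotMem hfst) (card_exits_insert_le hnotMem hsnd)
    change halfPerimeter _ ≤ halfPerimeter _ at hper
    rw [← Nat.cast_le (α := ℝ)] at hper
    have hcard := congrArg (Nat.cast (R := ℝ)) (Finset.card_insert_of_notMem hnotMem)
    push_cast at hcard
    have hrest := ih (C := insert y C) (Finset.insert_nonempty _ _)
      (Finset.insert_subset hyB hCB)
      (by rw [product_union_insert, hcard]; nlinarith)
      (by rw [Finset.sdiff_insert, Finset.card_erase_of_mem (by simp [hyB, hyC]), hn]; rfl)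
    rw [product_union_insert] at hrest
    exact Relation.ReflTransGen.head ⟨by rw [hcard]; linarith, _, hnotMem, rfl⟩ hrest

theorem grows_insert_vertex (hg : 0 ≤ g) (hB : (exits 1 B).card ≤ 1) (hx : x ∉ A)
    (hxA : x + 1 ∈ A ∨ x - 1 ∈ A) {y : ZMod L} (hy : y ∈ B)
    (hθ : 2 * (halfPerimeter (insert (x, y) (A ×ˢ B)) : ℝ) -
      g * ((insert (x, y) (A ×ˢ B)).card + 1) < θ) :
    Grows g θ (insert (x, y) (A ×ˢ B)) (insert x A ×ˢ B) := by
  have hunion : A ×ˢ B ∪ {x} ×ˢ {y} = insert (x, y) (A ×ˢ B) := by simp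
  rw [← hunion] at hθ ⊢
  exact grows_union_bar hg hB hx hxA (Finset.singleton_nonempty y)
    (Finset.singleton_subset_iff.2 hy) hθ

omit [NeZero L] in
theorem halfPerimeter_insert_vertex_le (hx : x ∉ A) (hxA : x + 1 ∈ A ∨ x - 1 ∈ A) {y : ZMod L}
    (hy : y ∈ B) : halfPerimeter (insert (x, y) (A ×ˢ B)) ≤ halfPerimeter (A ×ˢ B) + 1 := by
  have hfst := card_exits_insert_le (e := (1, 0)) (v := (x, y)) (A := A ×ˢ B) (by simp [hx])
    (by simpa [hy] using hxA)
  have hsnd := card_exits_insert_le_add_one (0, 1) (x, y) (A ×ˢ B)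
  rw [halfPerimeter, halfPerimeter]
  omega

theorem grows_insert_product (hg : 0 ≤ g) (hA : (exits 1 A).card ≤ 1) (hB : (exits 1 B).card ≤ 1)
    (hx : x ∉ A) (hxA : x + 1 ∈ A ∨ x - 1 ∈ A) (hne : B.Nonempty)
    (hθ : 2 * (A.card + B.card + 1 : ℝ) - g * (A.card * B.card + 1) < θ) :
    Grows g θ (A ×ˢ B) (insert x A ×ˢ B) := by
  obtain ⟨y, hy⟩ := hne
  have hnotMem : (x, y) ∉ A ×ˢ B := by simp [hx]
  have hper : halfPerimeter (insert (x, y) (A ×ˢ B)) ≤ A.card + B.card + 1 :=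
    (halfPerimeter_insert_vertex_le hx hxA hy).trans
      (Nat.add_le_add_right (halfPerimeter_product_le hA hB) 1)
  rw [← Nat.cast_le (α := ℝ)] at hper
  have hcard := congrArg (Nat.cast (R := ℝ)) (Finset.card_insert_of_notMem hnotMem)
  rw [Finset.card_product] at hcard
  push_cast at hper hcard
  have hbar : Grows g θ (insert (x, y) (A ×ˢ B)) (insert x A ×ˢ B) :=
    grows_insert_vertex hg hB hx hxA hy (by rw [hcard]; linarith)
  exact Relation.ReflTransGen.head ⟨by rw [hcard]; linarith, _, hnotMem, rfl⟩ hbar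

end Bar

section Rectangles

variable [NeZero K] [NeZero L] {n n' : ℕ} {x₀ : ZMod K} {y₀ : ZMod L}

theorem grows_rows (hg : 0 ≤ g) (hm : 0 < m) (hmm' : m ≤ m') (hm' : m' ≤ K) (hn : 0 < n)
    (hnL : n ≤ L)
    (hθ : ∀ i : ℕ, m ≤ i → i < m' → 2 * (i + n + 1 : ℝ) - g * (i * n + 1) < θ) :
    Grows g θ (arc x₀ m ×ˢ arc y₀ n) (arc x₀ m' ×ˢ arc y₀ n) := by
  induction m', hmm' using Nat.le_induction with
  | base => exact Relation.ReflTransGen.refl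
  | succ i hi ih =>
    refine (ih (by omega) fun j hmj hji => hθ j hmj (by omega)).trans ?_
    have hiK : i < K := hm'
    rw [arc_succ hiK]
    refine grows_insert_product hg (card_exits_arc_le _ _) (card_exits_arc_le _ _)
      (add_natCast_notMem_arc hiK) (add_one_or_sub_one_mem_arc (by omega) hiK (Or.inl rfl))
      ⟨y₀, self_mem_arc.2 hn⟩ ?_
    rw [card_arc hiK.le, card_arc hnL]
    exact hθ i hi (by omega)

theorem grows_columns (hg : 0 ≤ g) (hn : 0 < n) (hnn' : n ≤ n') (hn' : n' ≤ L) (hm : 0 < m)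
    (hmK : m ≤ K)
    (hθ : ∀ i : ℕ, n ≤ i → i < n' → 2 * (i + m + 1 : ℝ) - g * (i * m + 1) < θ) :
    Grows g θ (arc x₀ m ×ˢ arc y₀ n) (arc x₀ m ×ˢ arc y₀ n') := by
  rw [← transpose_product, ← transpose_product (arc y₀ n')]
  exact (grows_rows hg hn hnn' hn' hm hmK hθ).transpose

theorem grows_empty_vertex (x₀ : ZMod K) (y₀ : ZMod L) (hθ : 4 - g < θ) :
    Grows g θ ∅ (arc x₀ 1 ×ˢ arc y₀ 1) := by
  have hper := halfPerimeter_product_le (card_exits_arc_le x₀ 1) (card_exits_arc_le y₀ 1)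
  rw [card_arc NeZero.one_le, card_arc NeZero.one_le, ← Nat.cast_le (α := ℝ)] at hper
  refine Relation.ReflTransGen.single ⟨?_, (x₀, y₀), Finset.notMem_empty _, by simp [arc_one]⟩
  rw [Finset.card_product, card_arc NeZero.one_le, card_arc NeZero.one_le]
  push_cast at hper ⊢
  linarith

end Rectangles

end Growth

section Nucleus

variable {k : ℕ} {h : ℝ}

theorem rectangle_energy_lt_barrier (hk : h * k < 2) {j : ℕ} (hj : j ≤ k) :
    2 * (j + k + 1 : ℝ) - h * (j * k + 1) < barrier k h := by
  have hj' : (j : ℝ) ≤ k := by exact_mod_cast hj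
  rw [barrier]
  nlinarith [mul_nonneg (sub_nonneg.2 hj') (sub_nonneg.2 hk.le)]

theorem strip_energy_lt_barrier (h_lt : h < 1) (hk1 : 1 ≤ k) (hk : h * k < 2) {j : ℕ}
    (hj : j ≤ k) : 2 * (j + 1 + 1 : ℝ) - h * (j * 1 + 1) < barrier k h := by
  have hstrip := rectangle_energy_lt_barrier hk hk1
  have hj' : (j : ℝ) ≤ k := by exact_mod_cast hj
  push_cast at hstrip
  nlinarith [mul_nonneg (sub_nonneg.2 hj') (sub_nonneg.2 h_lt.le)]

theorem single_energy_lt_barrier (h_lt : h < 1) (hk1 : 1 ≤ k) (hk : h * k < 2) :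
    4 - h < barrier k h := by
  have hstrip := strip_energy_lt_barrier h_lt hk1 hk (Nat.zero_le k)
  push_cast at hstrip
  linarith

theorem large_rectangle_energy_lt_barrier (h_pos : 0 < h) (hk : 2 < h * (k + 1)) {m n : ℕ}
    (hm : k + 1 ≤ m) (hn : k + 1 ≤ n) :
    2 * (m + n + 1 : ℝ) - h * (m * n + 1) < barrier k h := by
  have hm' : (0 : ℝ) ≤ m - (k + 1) := by
    rw [sub_nonneg]; exact_mod_cast hm
  have hn' : (0 : ℝ) ≤ n - (k + 1) := by
    rw [sub_nonneg]; exact_mod_cast hn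
  rw [barrier]
  nlinarith [mul_nonneg h_pos.le (mul_nonneg hm' hn'), mul_nonneg hm' (sub_nonneg.2 hk.le),
    mul_nonneg hn' (sub_nonneg.2 hk.le)]

variable [NeZero K] [NeZero L]

theorem grows_empty_quasiSquare (h_pos : 0 < h) (h_lt : h < 1) (hk1 : 1 ≤ k) (hk : h * k < 2)
    (hK : k ≤ K) (hL : k + 1 ≤ L) (x₀ : ZMod K) (y₀ : ZMod L) :
    Grows h (barrier k h) ∅ (arc x₀ k ×ˢ arc y₀ (k + 1)) := by
  have hstrip : Grows h (barrier k h) (arc x₀ 1 ×ˢ arc y₀ 1) (arc x₀ k ×ˢ arc y₀ 1) :=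
    grows_rows h_pos.le one_pos hk1 hK one_pos (by omega) fun i _ hi => by
      simpa using strip_energy_lt_barrier h_lt hk1 hk hi.le
  have hcolumns : Grows h (barrier k h) (arc x₀ k ×ˢ arc y₀ 1) (arc x₀ k ×ˢ arc y₀ (k + 1)) :=
    grows_columns h_pos.le one_pos (by omega) hL hk1 hK fun i _ hi =>
      rectangle_energy_lt_barrier hk (by omega)
  exact ((grows_empty_vertex x₀ y₀ (single_energy_lt_barrier h_lt hk1 hk)).trans hstrip).trans
    hcolumns

theorem grows_square_univ (h_pos : 0 < h) (hk : 2 < h * (k + 1)) (hK : k + 1 ≤ K)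
    (hL : k + 1 ≤ L) (x₀ : ZMod K) (y₀ : ZMod L) :
    Grows h (barrier k h) (arc x₀ (k + 1) ×ˢ arc y₀ (k + 1)) Finset.univ := by
  have hrows : Grows h (barrier k h) (arc x₀ (k + 1) ×ˢ arc y₀ (k + 1))
      (arc x₀ K ×ˢ arc y₀ (k + 1)) :=
    grows_rows h_pos.le k.succ_pos hK le_rfl k.succ_pos hL fun i hi _ =>
      large_rectangle_energy_lt_barrier h_pos hk hi le_rfl
  have hcolumns : Grows h (barrier k h) (arc x₀ K ×ˢ arc y₀ (k + 1)) (arc x₀ K ×ˢ arc y₀ L) :=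
    grows_columns h_pos.le k.succ_pos hL le_rfl (by omega) le_rfl fun i hi _ =>
      large_rectangle_energy_lt_barrier h_pos hk hi hK
  rw [← Finset.univ_product_univ, ← arc_univ (x₀ := x₀), ← arc_univ (x₀ := y₀)]
  exact hrows.trans hcolumns

theorem grows_empty_univ {θ : ℝ} (hθ : 2 * (K + L + 1 : ℝ) < θ) :
    Grows 0 θ (∅ : Finset (Vertex K L)) Finset.univ := by
  have hbound (m n : ℕ) (hm : m ≤ K) (hn : n ≤ L) : 2 * (m + n + 1 : ℝ) - 0 * (m * n + 1) < θ := by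
    have hm' : (m : ℝ) ≤ K := by exact_mod_cast hm
    have hn' : (n : ℝ) ≤ L := by exact_mod_cast hn
    linarith
  have hK : 1 ≤ K := NeZero.one_le
  have hL : 1 ≤ L := NeZero.one_le
  have hsingle : (4 : ℝ) - 0 < θ := by
    have hone := hbound 1 1 hK hL
    push_cast at hone
    linarith
  have hrows : Grows 0 θ (arc (0 : ZMod K) 1 ×ˢ arc (0 : ZMod L) 1) (arc 0 K ×ˢ arc 0 1) :=
    grows_rows le_rfl one_pos hK le_rfl one_pos hL fun i _ hi => hbound i 1 hi.le hL
  have hcolumns : Grows 0 θ (arc (0 : ZMod K) K ×ˢ arc (0 : ZMod L) 1) (arc 0 K ×ˢ arc 0 L) :=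
    grows_columns le_rfl one_pos hL le_rfl hK le_rfl fun i _ hi => by
      simpa only [add_comm (i : ℝ), mul_comm (i : ℝ)] using hbound K i le_rfl hi.le
  rw [← Finset.univ_product_univ, ← arc_univ (x₀ := (0 : ZMod K)), ← arc_univ (x₀ := (0 : ZMod L))]
  exact ((grows_empty_vertex 0 0 hsingle).trans hrows).trans hcolumns

/-- The shape of a critical configuration: a set with the area and at most the perimeter of a
quasi-square with a unit protuberance that is reached from the empty set by growth below the
barrier and one last vertex, and that grows below the barrier to the whole torus. -/
structure IsCriticalNucleus (k : ℕ) (h : ℝ) (D : Finset (Vertex K L)) : Prop where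
  halfPerimeter_le : halfPerimeter D ≤ 2 * (k + 1)
  card_eq : D.card = k * (k + 1) + 1
  exists_insert : ∃ R, ∃ v ∉ R, D = insert v R ∧ Grows h (barrier k h) ∅ R
  grows_univ : Grows h (barrier k h) D Finset.univ

theorem IsCriticalNucleus.transpose {D : Finset (Vertex K L)}
    (hD : IsCriticalNucleus k h D) : IsCriticalNucleus k h (transpose D) := by
  obtain ⟨R, v, hv, hDR, hR⟩ := hD.exists_insert
  refine ⟨by rw [halfPerimeter_transpose]; exact hD.halfPerimeter_le,
    by rw [card_transpose]; exact hD.card_eq,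
    ⟨Potts.transpose R, v.swap, by simpa using hv, by rw [hDR, transpose_insert],
      hR.transpose⟩, ?_⟩
  have huniv : Potts.transpose (Finset.univ : Finset (Vertex K L)) = Finset.univ := by ext; simp
  exact huniv ▸ hD.grows_univ.transpose

theorem isCriticalNucleus_insert (h_pos : 0 < h) (h_lt : h < 1) (hk1 : 1 ≤ k) (hk : h * k < 2)
    (hk' : 2 < h * (k + 1)) (hK : k + 1 ≤ K) (hL : k + 1 ≤ L) {x x₀ : ZMod K} {y y₀ : ZMod L}
    (hx : x = x₀ + k ∨ x = x₀ - 1) (hy : y ∈ arc y₀ (k + 1)) :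
    IsCriticalNucleus k h (insert (x, y) (arc x₀ k ×ˢ arc y₀ (k + 1))) := by
  have hxA : x ∉ arc x₀ k := notMem_arc_of_eq hK hx
  have hadj := add_one_or_sub_one_mem_arc hk1 hK hx
  have hxy : (x, y) ∉ arc x₀ k ×ˢ arc y₀ (k + 1) := by simp [hxA]
  have hcard : (insert (x, y) (arc x₀ k ×ˢ arc y₀ (k + 1))).card = k * (k + 1) + 1 := by
    rw [Finset.card_insert_of_notMem hxy, Finset.card_product, card_arc (by omega), card_arc hL]
  have hper : halfPerimeter (insert (x, y) (arc x₀ k ×ˢ arc y₀ (k + 1))) ≤ 2 * (k + 1) := by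
    have hproduct := halfPerimeter_product_le (card_exits_arc_le x₀ k)
      (card_exits_arc_le y₀ (k + 1))
    have hinsert := halfPerimeter_insert_vertex_le hxA hadj hy
    rw [card_arc (by omega), card_arc hL] at hproduct
    omega
  refine ⟨hper, hcard,
    ⟨_, _, hxy, rfl, grows_empty_quasiSquare h_pos h_lt hk1 hk (by omega) hL x₀ y₀⟩,
    (grows_insert_vertex h_pos.le (card_exits_arc_le _ _) hxA hadj hy ?_).trans ?_⟩
  · rw [hcard, barrier]
    rw [← Nat.cast_le (α := ℝ)] at hper
    push_cast at hper ⊢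
    linarith
  · obtain ⟨x₁, hx₁⟩ := exists_insert_eq_arc hK hx
    rw [hx₁]
    exact grows_square_univ h_pos hk' hK hL x₁ y₀

theorem rectangle_union_vertex (x₀ x : ZMod K) (y₀ y : ZMod L) (m n : ℕ) :
    rectangle (x₀, y₀) m n ∪ rectangle (x, y) 1 1 =
      (insert (x, y) (arc x₀ m ×ˢ arc y₀ n) : Finset (Vertex K L)) := by
  rw [rectangle_one_one, Set.union_singleton, Finset.coe_insert, coe_arc_product]

theorem isCriticalNucleus_of_mem_rectanglesWithBar (h_pos : 0 < h) (h_lt : h < 1) (hk1 : 1 ≤ k)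
    (hk : h * k < 2) (hk' : 2 < h * (k + 1)) (hK : k + 1 ≤ K) (hL : k + 1 ≤ L)
    {D : Finset (Vertex K L)} (hD : ↑D ∈ rectanglesWithBar K L k (k + 1) 1) :
    IsCriticalNucleus k h D := by
  obtain ⟨⟨x₀, y₀⟩, c, hc, hD⟩ := hD
  simp only [Prod.mk_add_mk, rectangle_union_vertex, ← sub_eq_add_neg, Finset.coe_inj] at hD
  have hx : x₀ + c ∈ arc x₀ (k + 1) := add_natCast_mem_arc hc
  have hy : y₀ + c ∈ arc y₀ (k + 1) := add_natCast_mem_arc hc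
  have hrow {x : ZMod K} (hside : x = x₀ + k ∨ x = x₀ - 1) :=
    isCriticalNucleus_insert h_pos h_lt hk1 hk hk' hK hL hside hy
  have hcolumn {y : ZMod L} (hside : y = y₀ + k ∨ y = y₀ - 1) :=
    (isCriticalNucleus_insert h_pos h_lt hk1 hk hk' hL hK hside hx).transpose
  simp only [transpose_insert, transpose_product, Prod.swap_prod_mk] at hcolumn
  rcases hD with rfl | rfl | rfl | rfl
  · exact hrow (Or.inl rfl)
  · exact hrow (Or.inr rfl)
  · exact hcolumn (Or.inl rfl)
  · exact hcolumn (Or.inr rfl)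

end Nucleus

/-! ### Optimal paths through the critical set -/

section Painting

variable {r c : Spin q} {R R' : Finset (Vertex K L)} {g h θ E : ℝ}

/-- The configuration with the spin `c` in `R` and the spin `r` outside. -/
def paint (r c : Spin q) (R : Finset (Vertex K L)) : Config K L q :=
  fun v => if v ∈ R then c else r

theorem paint_empty (r c : Spin q) : paint r c (∅ : Finset (Vertex K L)) = fun _ => r := by
  funext; simp [paint]

theorem paint_insert (v : Vertex K L) :
    paint r c (insert v R) = Function.update (paint r c R) v c := by
  funext w
  by_cases hw : w = v
  · subst hw; simp [paint]
  · simp [paint, hw]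

variable [NeZero K] [NeZero L]

theorem paint_univ (r c : Spin q) : paint r c (Finset.univ : Finset (Vertex K L)) = fun _ => c := by
  funext; simp [paint]

theorem wall_paint (hrc : r ≠ c) : wall (paint r c R) = 2 * halfPerimeter R := by
  have hmem (v : Vertex K L) : v ∈ R ↔ paint r c R v ≠ r := by
    by_cases hv : v ∈ R <;> simp [paint, hv, hrc.symm]
  have hdisagreements (e : Vertex K L) :
      disagreements e (paint r c R) = 2 * (exits e R).card := by
    rw [disagreements_eq_two_mul_card_exits_add e _ hmem, add_eq_left, Finset.card_eq_zero,
      Finset.filter_eq_empty_iff]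
    simp +contextual [paint]
  rw [wall, hdisagreements, hdisagreements, halfPerimeter, mul_add]

variable [NeZero q]

theorem connectivity_paint_insert_pos (hrc : r ≠ c) {v : Vertex K L} (hv : v ∉ R) :
    0 < connectivity (paint r c R) (paint r c (insert v R)) := by
  rw [paint_insert]
  exact connectivity_update_pos (by simpa [paint, hv] using hrc)

/-- Reachability by single spin flips that lead to configurations of energy below `Γ`. -/
def ReachableBelow (h Γ : ℝ) : Config K L q → Config K L q → Prop :=
  Relation.ReflTransGen fun σ σ' => 0 < connectivity σ σ' ∧ energy h σ' < Γ

theorem energy_paint_spinOne (hK : 3 ≤ K) (hL : 3 ≤ L) (h : ℝ) (hc : c ≠ spinOne q)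
    (R : Finset (Vertex K L)) :
    energy h (paint (spinOne q) c R) =
      -2 * (K * L) + h * (K * L) + (2 * halfPerimeter R - h * R.card) := by
  have hnonOne : nonOne (paint (spinOne q) c R) = R := by
    ext v
    by_cases hv : v ∈ R <;> simp [mem_nonOne, paint, hv, hc]
  rw [energy_eq hK hL, wall_paint hc.symm, hnonOne]
  push_cast
  ring

theorem energy_paint_of_ne (hK : 3 ≤ K) (hL : 3 ≤ L) (h : ℝ) (hr : r ≠ spinOne q)
    (hc : c ≠ spinOne q) (hrc : r ≠ c) (R : Finset (Vertex K L)) :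
    energy h (paint r c R) = -2 * (K * L) + (2 * halfPerimeter R - 0 * R.card) := by
  have hnonOne : nonOne (paint r c R) = Finset.univ := by
    ext v
    by_cases hv : v ∈ R <;> simp [mem_nonOne, paint, hv, hc, hr]
  rw [energy_eq hK hL, wall_paint hrc, hnonOne, card_vertex]
  push_cast
  ring

theorem Grows.reachableBelow_paint (hR : Grows g θ R R') (hrc : r ≠ c)
    (henergy : ∀ S : Finset (Vertex K L),
      energy h (paint r c S) = E + (2 * halfPerimeter S - g * S.card)) :
    ReachableBelow h (E + θ) (paint r c R) (paint r c R') := by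
  refine Relation.ReflTransGen.lift (paint r c) (fun S S' hS => ?_) _ _ hR
  obtain ⟨hlt, v, hv, rfl⟩ := hS
  exact ⟨connectivity_paint_insert_pos hrc hv, by rw [henergy]; linarith⟩

end Painting

section Bottleneck

variable {k : ℕ} [NeZero K] [NeZero L] [NeZero q] {h : ℝ}

theorem mem_criticalSet_iff (hcrit : criticalLength h = k + 1) {w : Config K L q} :
    w ∈ criticalSet K L q h ↔ ∃ t ≠ spinOne q, ∃ D : Finset (Vertex K L),
      ↑D ∈ rectanglesWithBar K L k (k + 1) 1 ∧ w = paint (spinOne q) t D := by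
  simp only [criticalSet, hcrit, Nat.add_sub_cancel, Set.mem_iUnion, Set.mem_ofPred_eq, barB,
    exists_prop]
  refine exists_congr fun t => and_congr_right fun _ => ⟨?_, ?_⟩
  · rintro ⟨S, hS, hw⟩
    classical
    refine ⟨S.toFinset, by simpa using hS, funext fun v => ?_⟩
    by_cases hv : v ∈ S <;> simp [paint, hv, hw]
  · rintro ⟨D, hD, rfl⟩
    exact ⟨D, hD, fun v => by simp +contextual [paint]⟩

theorem criticalSet_nonempty (hq : 1 < q) (hcrit : criticalLength h = k + 1) :
    (criticalSet K L q h).Nonempty := by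
  obtain ⟨t, ht⟩ := exists_spin_ne_one hq
  exact ⟨_, (mem_criticalSet_iff hcrit).2 ⟨t, ht, _, insert_arc_product_mem_rectanglesWithBar
    (x₀ := 0) (y₀ := 0) (Or.inl rfl) (self_mem_arc.2 k.succ_pos), rfl⟩⟩

theorem IsCriticalNucleus.energy_paint {D : Finset (Vertex K L)} (hD : IsCriticalNucleus k h D)
    (hk1 : 1 ≤ k) (hK : 3 * (k + 1) ≤ K) (hL : 3 * (k + 1) ≤ L) {t : Spin q}
    (ht : t ≠ spinOne q) : energy h (paint (spinOne q) t D) = saddleEnergy K L k h := by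
  have hper : halfPerimeter D = 2 * (k + 1) :=
    hD.halfPerimeter_le.antisymm (two_mul_le_halfPerimeter hK hL (by rw [hD.card_eq]; omega)
      (by rw [hD.card_eq]; nlinarith))
  rw [energy_paint_spinOne (by omega) (by omega) h ht, hper, hD.card_eq, saddleEnergy, barrier]
  push_cast
  ring

theorem reachableBelow_const (h_pos : 0 < h) (h_lt : h < 1) (hk1 : 1 ≤ k) (hk : h * k < 2)
    (hk' : 2 < h * (k + 1)) (hK : 3 * (k + 1) ≤ K) (hL : 3 * (k + 1) ≤ L) {r c : Spin q}
    (hr : r ≠ spinOne q) (hc : c ≠ spinOne q) :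
    ReachableBelow h (saddleEnergy K L k h) (fun _ : Vertex K L => r) (fun _ => c) := by
  obtain rfl | hrc := eq_or_ne r c
  · exact Relation.ReflTransGen.refl
  have hfield : 2 * (K + L + 1 : ℝ) < h * (K * L) + barrier k h := by
    have hbarrier := single_energy_lt_barrier h_lt hk1 hk
    have hK' : (3 * (k + 1) : ℝ) ≤ K := by exact_mod_cast hK
    have hL' : (3 * (k + 1) : ℝ) ≤ L := by exact_mod_cast hL
    have hhK : 6 ≤ h * K := by nlinarith [mul_le_mul_of_nonneg_left hK' h_pos.le]
    have hhL : 6 ≤ h * L := by nlinarith [mul_le_mul_of_nonneg_left hL' h_pos.le]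
    nlinarith [mul_le_mul_of_nonneg_right hhK (Nat.cast_nonneg (α := ℝ) L),
      mul_le_mul_of_nonneg_right hhL (Nat.cast_nonneg (α := ℝ) K)]
  have hreach := (grows_empty_univ (K := K) (L := L) hfield).reachableBelow_paint hrc
    (energy_paint_of_ne (by omega) (by omega) h hr hc hrc)
  rwa [paint_empty, paint_univ, ← add_assoc] at hreach

theorem exists_path_through_criticalSet (hcrit : criticalLength h = k + 1) (h_pos : 0 < h)
    (h_lt : h < 1) (hk1 : 1 ≤ k) (hk : h * k < 2) (hk' : 2 < h * (k + 1)) (hK : 3 * (k + 1) ≤ K)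
    (hL : 3 * (k + 1) ≤ L) {w : Config K L q} (hw : w ∈ criticalSet K L q h) {c : Spin q}
    (hc : c ≠ spinOne q) :
    energy h w = saddleEnergy K L k h ∧
      ∃ ω ∈ EnergyLandscape.paths connectivity (allOne K L q) {fun _ => c}, w ∈ ω ∧
        ∀ x ∈ ω, x ≠ w → energy h x < saddleEnergy K L k h := by
  obtain ⟨t, ht, D, hD, rfl⟩ := (mem_criticalSet_iff hcrit).1 hw
  replace hD := isCriticalNucleus_of_mem_rectanglesWithBar h_pos h_lt hk1 hk hk' (by omega)
    (by omega) hD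
  refine ⟨hD.energy_paint hk1 hK hL ht, ?_⟩
  obtain ⟨R, v, hv, rfl, hR⟩ := hD.exists_insert
  have henergy := energy_paint_spinOne (K := K) (L := L) (by omega) (by omega) h ht
  have hone : paint (spinOne q) t ∅ = allOne K L q := paint_empty _ _
  have hbelow : energy h (allOne K L q) < saddleEnergy K L k h := by
    have hbarrier := single_energy_lt_barrier h_lt hk1 hk
    have hper : halfPerimeter (∅ : Finset (Vertex K L)) = 0 := by simp [halfPerimeter, exits]
    rw [← hone, henergy, hper, saddleEnergy, Finset.card_empty]
    push_cast
    linarith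
  have hto := hR.reachableBelow_paint ht.symm henergy
  rw [hone] at hto
  have hfrom := hD.grows_univ.reachableBelow_paint ht.symm henergy
  rw [paint_univ] at hfrom
  have hmono {x y : Config K L q} (hxy : ReachableBelow h (saddleEnergy K L k h) x y) :
      Relation.ReflTransGen (fun x y => 0 < connectivity x y ∧
        (y ≠ paint (spinOne q) t (insert v R) → energy h y < saddleEnergy K L k h)) x y :=
    Relation.ReflTransGen.mono (fun _ _ hstep => hstep.imp_right fun hlt _ => hlt) _ _ hxy
  exact EnergyLandscape.exists_mem_paths_of_reflTransGen (fun _ => hbelow)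
    ((hmono hto).tail ⟨connectivity_paint_insert_pos ht.symm hv, fun hne => absurd rfl hne⟩)
    (hmono (hfrom.trans (reachableBelow_const h_pos h_lt hk1 hk hk' hK hL ht hc)))

theorem isBottleneck_criticalSet (hq : 1 < q) (hcrit : criticalLength h = k + 1) (h_pos : 0 < h)
    (h_lt : h < 1) (hk1 : 1 ≤ k) (hk : h * k < 2) (hk' : 2 < h * (k + 1)) (hK : 3 * (k + 1) ≤ K)
    (hL : 3 * (k + 1) ≤ L) {A : Set (Config K L q)}
    (hA : A ⊆ EnergyLandscape.stableStates (energy h)) (hne : A.Nonempty) :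
    EnergyLandscape.IsBottleneck (energy h) connectivity (allOne K L q) A (criticalSet K L q h)
      (saddleEnergy K L k h) := by
  obtain ⟨s, hs⟩ := hne
  obtain ⟨c, hc, rfl⟩ :=
    exists_eq_const_of_mem_stableStates hq h_pos (by omega) (by omega) (hA hs)
  have hthrough {w : Config K L q} (hw : w ∈ criticalSet K L q h) :=
    exists_path_through_criticalSet hcrit h_pos h_lt hk1 hk hk' hK hL hw hc
  refine ⟨criticalSet_nonempty hq hcrit,
    fun ω => exists_mem_criticalSet hq hcrit hk1 h_pos hk hK hL hA, fun w hw => (hthrough hw).1,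
    fun w hw => ?_⟩
  obtain ⟨-, ω, ⟨hhead, hlast⟩, hω⟩ := hthrough hw
  exact ⟨ω, ⟨hhead, by rwa [Set.mem_singleton_iff.1 hlast]⟩, hω⟩

end Bottleneck

end Potts

theorem theorem4p10_general (K L q : ℕ) [NeZero K] [NeZero L] [NeZero q] (hq : 1 < q)
    (h : ℝ) (h_pos : 0 < h) (h_lt : h < 1) (h_int : ∀ n : ℤ, 2 / h ≠ n)
    (hK : 3 * Potts.criticalLength h ≤ K) (hL : 3 * Potts.criticalLength h ≤ L)
    {A : Set (Potts.Config K L q)} (hA : A ⊆ EnergyLandscape.stableStates (Potts.energy h))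
    (hne : A.Nonempty) (W : Set (Potts.Config K L q)) :
    EnergyLandscape.IsMinimalGate (Potts.energy h) Potts.connectivity (Potts.allOne K L q) A W ↔
      W = Potts.criticalSet K L q h := by
  obtain ⟨k, hcrit, hk2, hk, hk'⟩ := Potts.exists_criticalLength_eq h_pos h_lt h_int
  rw [hcrit] at hK hL
  exact (Potts.isBottleneck_criticalSet hq hcrit h_pos h_lt (by omega) hk hk' hK hL hA
    hne).isMinimalGate_iff

theorem theorem4p10 (K L q : ℕ) [NeZero K] [NeZero L] [NeZero q] (hq : 2 < q)
    (h : ℝ) (h_pos : 0 < h) (h_lt : h < 1) (h_int : ∀ n : ℤ, 2 / h ≠ n)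
    (hK : 3 * Potts.criticalLength h ≤ K) (hL : 3 * Potts.criticalLength h ≤ L)
    (s : Potts.Config K L q)
    (hs : s ∈ EnergyLandscape.stableStates (Potts.energy (K := K) (L := L) (q := q) h)) :
    EnergyLandscape.IsMinimalGate (Potts.energy h) Potts.connectivity
      (Potts.allOne K L q) {s} (Potts.criticalSet K L q h) ∧
    EnergyLandscape.gateUnion (Potts.energy h) Potts.connectivity (Potts.allOne K L q) {s} =
      EnergyLandscape.gateUnion (Potts.energy h) Potts.connectivity (Potts.allOne K L q)
        (EnergyLandscape.stableStates (Potts.energy h)) := by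
  have hgate {A : Set (Potts.Config K L q)}
      (hA : A ⊆ EnergyLandscape.stableStates (Potts.energy h)) (hne : A.Nonempty) :=
    theorem4p10_general K L q (by omega) h h_pos h_lt h_int hK hL hA hne
  have hs' := hgate (Set.singleton_subset_iff.2 hs) (Set.singleton_nonempty s)
  exact ⟨(hs' _).2 rfl, by simp only [EnergyLandscape.gateUnion, hs', hgate subset_rfl ⟨s, hs⟩]⟩
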